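/- Let $K$ be a field, let $L$ be a finite distributive lattice, and let $A$ be the incidence algebra of $L$ over $K$, i.e. the $K$-algebra with basis $p^a_b$ for $a\le b$ in $L$ and multiplication $p^{a}_{b}\,p^{c}_{d}=p^{a}_{d}$ if $b=c$ and $p^{a}_{b}\,p^{c}_{d}=0$ otherwise. All modules are right $A$-modules. For $x\in L$ let $S_x$ be the corresponding simple module: it is one-dimensional over $K$, $p^x_x$ acts on it as the identity and all other basis elements act as zero. Let $\operatorname{cov}(x)$ be the set of elements of $L$ covering $x$ and $\operatorname{cocov}(x)$ the set of elements covered by $x$. For a module $M$ put $$\operatorname{grade} M=\inf\{\ell\ge 0\mid \operatorname{Ext}^\ell_A(M,A)\ne 0\},\qquad \operatorname{cograde} M=\inf\{\ell\ge 0\mid \operatorname{Ext}^\ell_A(D(A),M)\neq 0\},$$ where $D(A)=\operatorname{Hom}_K(A,K)$ with right action $(\varphi a)(b)=\varphi(ab)$, and $\inf\emptyset=\infty$; let $\operatorname{pdim} M$ and $\operatorname{idim} M$ denote the projective and the injective dimension. Then for every $x\in L$ $$\operatorname{grade} S_x=\operatorname{pdim} S_x=|\operatorname{cov}(x)|\qquad\text{and}\qquad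 \operatorname{cograde} S_x=\operatorname{idim} S_x=|\operatorname{cocov}(x)|.$$ In particular every simple $A$-module $S$ is perfect, i.e. $\operatorname{pdim} S=\operatorname{grade} S<\infty$. -/

import Mathlib

open CategoryTheory MulOpposite

universe u v w

/-! A right module over a ring `A` is a left module over `Aᵐᵒᵖ`, the element `op a` acting as
right multiplication by `a`. -/

namespace RightModule

/-- The grade of a right `A`-module `M`: the infimum of all `ℓ ≥ 0` with `Ext^ℓ(M, A) ≠ 0`,
where `A` is the regular right module. The infimum of the empty set is `⊤`. -/
noncomputable def grade {A : Type w} [Ring A] (M : ModuleCat.{w} Aᵐᵒᵖ) : ℕ∞ :=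
  sInf {n : ℕ∞ | ∃ l : ℕ, n = l ∧ Nontrivial (Abelian.Ext M (ModuleCat.of Aᵐᵒᵖ A) l)}

/-- The `K`-linear dual `D(A) = Hom_K(A, K)`, to be regarded as a right `A`-module. -/
def DualModule (K : Type u) (A : Type w) [Field K] [Ring A] [Algebra K A] : Type (max u w) :=
  Module.Dual K A

noncomputable instance (K : Type u) (A : Type w) [Field K] [Ring A] [Algebra K A] :
    AddCommGroup (DualModule K A) :=
  inferInstanceAs (AddCommGroup (Module.Dual K A))

/-- Precomposition with left multiplications: `op a` acts on linear forms by
`φ ↦ (b ↦ φ (a * b))`. -/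
noncomputable def dualAction (K : Type u) (A : Type w) [Field K] [Ring A] [Algebra K A] :
    Aᵐᵒᵖ →+* Module.End K (Module.Dual K A) where
  toFun a := Module.Dual.transpose (LinearMap.mulLeft K a.unop)
  map_one' := by ext; simp [Module.Dual.transpose_apply]
  map_mul' a a' := by ext; simp [Module.Dual.transpose_apply]
  map_zero' := by ext; simp
  map_add' a a' := by ext; simp [Module.Dual.transpose_apply, add_mul]

/-- The right action on `D(A)` is `(φ · a)(b) = φ (a * b)`. -/
noncomputable instance (K : Type u) (A : Type w) [Field K] [Ring A] [Algebra K A] :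
    Module Aᵐᵒᵖ (DualModule K A) :=
  Module.compHom (Module.Dual K A) (dualAction K A)

theorem DualModule.op_smul_apply (K : Type u) (A : Type w) [Field K] [Ring A] [Algebra K A]
    (φ : DualModule K A) (a b : A) :
    DFunLike.coe (F := Module.Dual K A) (op a • φ) b =
      DFunLike.coe (F := Module.Dual K A) φ (a * b) := rfl

/-- The cograde of a right `A`-module `M`, for a `K`-algebra `A`: the infimum of all `ℓ ≥ 0` with
`Ext^ℓ(D(A), M) ≠ 0`. The infimum of the empty set is `⊤`. -/
noncomputable def cograde (K : Type u) {A : Type (max u v)} [Field K] [Ring A] [Algebra K A]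
    (M : ModuleCat.{max u v} Aᵐᵒᵖ) : ℕ∞ :=
  sInf {n : ℕ∞ | ∃ l : ℕ, n = l ∧
    Nontrivial (Abelian.Ext (ModuleCat.of Aᵐᵒᵖ (DualModule K A)) M l)}

/-- A right module is perfect if its projective dimension is finite and equals its grade. -/
def IsPerfect {A : Type w} [Ring A] (M : ModuleCat.{w} Aᵐᵒᵖ) : Prop :=
  projectiveDimension M = ((grade M : ℕ∞) : WithBot ℕ∞) ∧ projectiveDimension M < ⊤

end RightModule

namespace IncidenceAlgebra

variable (K : Type u) {L : Type v} [Field K] [PartialOrder L] [LocallyFiniteOrder L]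
  [DecidableEq L]

/-- The character `f ↦ f x x` of the incidence algebra. -/
def diagEval (x : L) : IncidenceAlgebra K L →+* K where
  toFun f := f x x
  map_one' := by simp [one_apply]
  map_mul' f g := by simp [mul_apply]
  map_zero' := rfl
  map_add' _ _ := rfl

/-- The simple right module `S_x`: a copy of `K` on which `f` acts as multiplication by `f x x`.
In terms of the basis `p_b^a` (`a ≤ b`) of the incidence algebra, `p_x^x` acts as the identity and
every other basis element acts as zero. -/
def SimpleAt (_x : L) : Type (max u v) := ULift.{v} K

instance (x : L) : AddCommGroup (SimpleAt K x) := inferInstanceAs (AddCommGroup (ULift.{v} K))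

instance (x : L) : Module (IncidenceAlgebra K L)ᵐᵒᵖ (SimpleAt K x) :=
  Module.compHom (ULift.{v} K)
    ((diagEval K x).fromOpposite fun _ _ => mul_comm _ _ : (IncidenceAlgebra K L)ᵐᵒᵖ →+* K)

theorem SimpleAt.op_smul_down (x : L) (f : IncidenceAlgebra K L) (s : SimpleAt K x) :
    ULift.down (op f • s : SimpleAt K x) = f x x * ULift.down s := rfl

/-- `S_x` as an object of the category of right modules. -/
abbrev simpleMod (x : L) : ModuleCat.{max u v} (IncidenceAlgebra K L)ᵐᵒᵖ :=
  ModuleCat.of _ (SimpleAt K x)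

theorem SimpleAt.isSimpleModule (x : L) :
    IsSimpleModule (IncidenceAlgebra K L)ᵐᵒᵖ (SimpleAt K x) := by
  have : Nontrivial (SimpleAt K x) := inferInstanceAs (Nontrivial (ULift.{v} K))
  rw [isSimpleModule_iff_toSpanSingleton_surjective]
  refine ⟨inferInstance, fun s hs t => ?_⟩
  have hs' : ULift.down s ≠ 0 := fun h => hs (ULift.ext _ _ h)
  refine ⟨op ((ULift.down t / ULift.down s) • (1 : IncidenceAlgebra K L)), ULift.ext _ _ ?_⟩
  rw [LinearMap.toSpanSingleton_apply, SimpleAt.op_smul_down]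
  simp [one_apply, hs']

end IncidenceAlgebra

/-! For a convex set `C`, the row vectors supported on `C` form a right module. The filter of
elements above `a` gives a projective module `P_a`, a row of `A`; the ideal below `a` gives an
injective module `I_a`, a summand of `D(A)`. Removing from the filter of `x` the filters of all
covers of `x` leaves only `x`, hence `S_x`. Removing one filter at a time gives short exact
sequences (`upperPart_shortExact`), an inductive form of a Koszul-like resolution with terms `P_c`,
where `c` is the join of `x` with a set of covers. Hence the projective dimension is at most the
number of covers.

As `A` is the sum of the `P_z`, the grade is read off from `Ext(S_x, P_z)`. Homomorphisms `P_c →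
P_z` are scalars, and zero unless `z ≤ c`. Distributivity enters twice. If every cover of `x` lies
below `x ⊔ z`, then `z ≤ c` forces all covers below `c`; since no cover lies below the join of the
others (`CovBy.exists_ge_not_ge`), only the last term of the resolution can contribute, and Ext
vanishes below the top degree. If some cover `y` is not below `x ⊔ z`, then joining with `y` does
not affect whether `z ≤ c`, the Hom complex cancels in pairs, and Ext vanishes altogether
(`subsingleton_ext_upperPart_insert`). Taking for `z` the join of `x` and its covers makes the top
Ext nonzero, which fixes both grade and projective dimension.

The injective half is the order dual, with ideals, meets, `I_a` and `D(A)`. The final claim follows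
because every simple module is some `S_x`. -/

set_option linter.unusedSectionVars false

/-! ### Dimension shifting for Ext along a short exact sequence. -/

namespace CategoryTheory.ShortComplex.ShortExact

open Abelian

variable {C : Type u} [Category.{v} C] [Abelian C] [HasExt.{w} C] {S : ShortComplex C}

theorem subsingleton_ext_X₃_zero (hS : S.ShortExact) {Z : C} (h₂ : Subsingleton (Ext S.X₂ Z 0)) :
    Subsingleton (Ext S.X₃ Z 0) :=
  have := hS.epi_g
  (Ext.precomp_mk₀_injective_of_epi Z S.g).subsingleton

theorem subsingleton_ext_X₃_succ (hS : S.ShortExact) {Z : C} {n : ℕ}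
    (h₁ : Subsingleton (Ext S.X₁ Z n)) (h₂ : Subsingleton (Ext S.X₂ Z (n + 1))) :
    Subsingleton (Ext S.X₃ Z (n + 1)) := by
  refine subsingleton_of_forall_eq 0 fun e => ?_
  obtain ⟨e', rfl⟩ := Ext.contravariant_sequence_exact₃ hS Z e (Subsingleton.elim _ _)
    (add_comm 1 n)
  rw [Subsingleton.elim e' 0, Ext.comp_zero]

theorem subsingleton_ext_X₃ (hS : S.ShortExact) {Z : C}
    (h₁ : ∀ n, Subsingleton (Ext S.X₁ Z n)) (h₂ : ∀ n, Subsingleton (Ext S.X₂ Z n)) :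
    ∀ n, Subsingleton (Ext S.X₃ Z n)
  | 0 => hS.subsingleton_ext_X₃_zero (h₂ 0)
  | n + 1 => hS.subsingleton_ext_X₃_succ (h₁ n) (h₂ (n + 1))

/-- The connecting map `Ext^n(X₁, Z) → Ext^(n+1)(X₃, Z)` is injective once `Ext^n(X₂, Z)` vanishes.
-/
theorem nontrivial_ext_X₃_succ (hS : S.ShortExact) {Z : C} {n : ℕ}
    (h₁ : Nontrivial (Ext S.X₁ Z n)) (h₂ : Subsingleton (Ext S.X₂ Z n)) :
    Nontrivial (Ext S.X₃ Z (n + 1)) := by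
  obtain ⟨e, he⟩ := exists_ne (0 : Ext S.X₁ Z n)
  refine ⟨hS.extClass.comp e (add_comm 1 n), 0, fun h => he ?_⟩
  obtain ⟨e', rfl⟩ := Ext.contravariant_sequence_exact₁ hS Z e _ h
  rw [Subsingleton.elim e' 0, Ext.comp_zero]

/-- If `Hom(-, Z)` turns the first map of a short exact sequence whose first two terms are
projective into a bijection, then `Ext(-, Z)` vanishes on the cokernel. -/
theorem subsingleton_ext_X₃_of_bijective (hS : S.ShortExact) {Z : C} [Projective S.X₁]
    [Projective S.X₂] (h : Function.Bijective fun f : S.X₂ ⟶ Z => S.f ≫ f) :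
    ∀ n, Subsingleton (Ext S.X₃ Z n)
  | 0 => by
    refine subsingleton_of_forall_eq 0 fun e => ?_
    obtain ⟨f, rfl⟩ := (Ext.mk₀_bijective _ _).2 e
    have := hS.epi_g
    rw [Ext.mk₀_eq_zero_iff, ← cancel_epi S.g, Limits.comp_zero]
    apply h.1
    simp
  | 1 => by
    refine subsingleton_of_forall_eq 0 fun e => ?_
    obtain ⟨e', rfl⟩ := Ext.contravariant_sequence_exact₃ hS Z e
      (Ext.eq_zero_of_hasProjectiveDimensionLT _ 1 le_rfl) (add_zero 1)
    obtain ⟨f, rfl⟩ := (Ext.mk₀_bijective _ _).2 e'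
    -- The class is the connecting image of a map `X₁ ⟶ Z`; surjectivity extends that map to `X₂`,
    -- and the connecting map kills whatever extends.
    obtain ⟨g, rfl⟩ := h.2 f
    have := hS.extClass_comp_assoc (Ext.mk₀ g) (h := add_zero 1)
    simpa using this
  | n + 2 => hS.subsingleton_ext_X₃_succ
      (HasProjectiveDimensionLT.subsingleton S.X₁ 1 (n + 1) (by lia) Z)
      (HasProjectiveDimensionLT.subsingleton S.X₂ 1 (n + 2) (by lia) Z)

theorem subsingleton_ext_X₁_zero (hS : S.ShortExact) {Z : C} (h₂ : Subsingleton (Ext Z S.X₂ 0)) :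
    Subsingleton (Ext Z S.X₁ 0) :=
  have := hS.mono_f
  (Ext.postcomp_mk₀_injective_of_mono Z S.f).subsingleton

theorem subsingleton_ext_X₁_succ (hS : S.ShortExact) {Z : C} {n : ℕ}
    (h₃ : Subsingleton (Ext Z S.X₃ n)) (h₂ : Subsingleton (Ext Z S.X₂ (n + 1))) :
    Subsingleton (Ext Z S.X₁ (n + 1)) := by
  refine subsingleton_of_forall_eq 0 fun e => ?_
  obtain ⟨e', rfl⟩ := Ext.covariant_sequence_exact₁ Z hS e (Subsingleton.elim _ _) rfl
  rw [Subsingleton.elim e' 0, Ext.zero_comp]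

theorem subsingleton_ext_X₁ (hS : S.ShortExact) {Z : C}
    (h₃ : ∀ n, Subsingleton (Ext Z S.X₃ n)) (h₂ : ∀ n, Subsingleton (Ext Z S.X₂ n)) :
    ∀ n, Subsingleton (Ext Z S.X₁ n)
  | 0 => hS.subsingleton_ext_X₁_zero (h₂ 0)
  | n + 1 => hS.subsingleton_ext_X₁_succ (h₃ n) (h₂ (n + 1))

theorem nontrivial_ext_X₁_succ (hS : S.ShortExact) {Z : C} {n : ℕ}
    (h₃ : Nontrivial (Ext Z S.X₃ n)) (h₂ : Subsingleton (Ext Z S.X₂ n)) :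
    Nontrivial (Ext Z S.X₁ (n + 1)) := by
  obtain ⟨e, he⟩ := exists_ne (0 : Ext Z S.X₃ n)
  refine ⟨e.comp hS.extClass rfl, 0, fun h => he ?_⟩
  obtain ⟨e', rfl⟩ := Ext.covariant_sequence_exact₃ Z hS e _ h
  rw [Subsingleton.elim e' 0, Ext.zero_comp]

/-- If `Hom(Z, -)` turns the second map of a short exact sequence whose last two terms are
injective into a bijection, then `Ext(Z, -)` vanishes on the kernel. -/
theorem subsingleton_ext_X₁_of_bijective (hS : S.ShortExact) {Z : C} [Injective S.X₂]
    [Injective S.X₃] (h : Function.Bijective fun f : Z ⟶ S.X₂ => f ≫ S.g) :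
    ∀ n, Subsingleton (Ext Z S.X₁ n)
  | 0 => by
    refine subsingleton_of_forall_eq 0 fun e => ?_
    obtain ⟨f, rfl⟩ := (Ext.mk₀_bijective _ _).2 e
    have := hS.mono_f
    rw [Ext.mk₀_eq_zero_iff, ← cancel_mono S.f, Limits.zero_comp]
    apply h.1
    simp
  | 1 => by
    refine subsingleton_of_forall_eq 0 fun e => ?_
    obtain ⟨e', rfl⟩ := Ext.covariant_sequence_exact₁ Z hS e
      (Ext.eq_zero_of_hasInjectiveDimensionLT _ 1 le_rfl) (zero_add 1)
    obtain ⟨f, rfl⟩ := (Ext.mk₀_bijective _ _).2 e'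
    obtain ⟨g, rfl⟩ := h.2 f
    simp only [← Ext.mk₀_comp_mk₀]
    rw [Ext.comp_assoc_of_second_deg_zero, hS.comp_extClass, Ext.comp_zero]
  | n + 2 => hS.subsingleton_ext_X₁_succ
      (HasInjectiveDimensionLT.subsingleton S.X₃ 1 (n + 1) (by lia) Z)
      (HasInjectiveDimensionLT.subsingleton S.X₂ 1 (n + 2) (by lia) Z)

end CategoryTheory.ShortComplex.ShortExact

/-! ### Ext under finite decompositions and retracts. -/

namespace CategoryTheory.Abelian.Ext

variable {C : Type u} [Category.{v} C] [Abelian C] [HasExt.{w} C]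

/-- `Ext(X, -)` vanishes on `Y` if the identity of `Y` is a sum of maps factoring through objects
on which `Ext(X, -)` vanishes. -/
theorem subsingleton_of_sum_comp_eq_id_right {X Y : C} {J : Type*} [Fintype J] {Z : J → C}
    (p : ∀ j, Y ⟶ Z j) (i : ∀ j, Z j ⟶ Y) (h : ∑ j, p j ≫ i j = 𝟙 Y) {n : ℕ}
    (hZ : ∀ j, Subsingleton (Ext X (Z j) n)) : Subsingleton (Ext X Y n) := by
  refine subsingleton_of_forall_eq 0 fun e => ?_
  rw [← e.comp_mk₀_id, ← h, mk₀_sum, comp_sum]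
  refine Finset.sum_eq_zero fun j _ => ?_
  rw [← mk₀_comp_mk₀, ← comp_assoc_of_second_deg_zero,
    Subsingleton.elim (e.comp (mk₀ (p j)) (add_zero n)) 0, zero_comp]

theorem subsingleton_of_sum_comp_eq_id_left {X Y : C} {J : Type*} [Fintype J] {Z : J → C}
    (p : ∀ j, Y ⟶ Z j) (i : ∀ j, Z j ⟶ Y) (h : ∑ j, p j ≫ i j = 𝟙 Y) {n : ℕ}
    (hZ : ∀ j, Subsingleton (Ext (Z j) X n)) : Subsingleton (Ext Y X n) := by
  refine subsingleton_of_forall_eq 0 fun e => ?_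
  rw [← e.mk₀_id_comp, ← h, mk₀_sum, sum_comp]
  refine Finset.sum_eq_zero fun j _ => ?_
  rw [← mk₀_comp_mk₀_assoc,
    Subsingleton.elim ((mk₀ (i j)).comp e (zero_add n)) 0, comp_zero]

theorem nontrivial_of_retract_right {X Y Z : C} (r : Retract Z Y) {n : ℕ}
    (h : Nontrivial (Ext X Z n)) : Nontrivial (Ext X Y n) := by
  obtain ⟨e, he⟩ := exists_ne (0 : Ext X Z n)
  refine ⟨e.comp (mk₀ r.i) (add_zero n), 0, fun h0 => he ?_⟩
  rw [← e.comp_mk₀_id, ← r.retract, ← mk₀_comp_mk₀, ← comp_assoc_of_second_deg_zero, h0, zero_comp]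

theorem nontrivial_of_retract_left {X Y Z : C} (r : Retract Z Y) {n : ℕ}
    (h : Nontrivial (Ext Z X n)) : Nontrivial (Ext Y X n) := by
  obtain ⟨e, he⟩ := exists_ne (0 : Ext Z X n)
  refine ⟨(mk₀ r.r).comp e (zero_add n), 0, fun h0 => he ?_⟩
  rw [← e.mk₀_id_comp, ← r.retract, ← mk₀_comp_mk₀_assoc, h0, comp_zero]

end CategoryTheory.Abelian.Ext

/-! ### Injectivity of `D(A)`. -/

namespace RightModule

variable {K : Type u} {A : Type w} [Field K] [Ring A] [Algebra K A]

/-- The elements of `D(A)` as linear forms. -/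
noncomputable def DualModule.toDual : DualModule K A →+ Module.Dual K A :=
  AddMonoidHom.id (Module.Dual K A)

theorem DualModule.ext {φ ψ : DualModule K A} (h : ∀ a, toDual φ a = toDual ψ a) : φ = ψ :=
  LinearMap.ext (f := toDual φ) (g := toDual ψ) h

theorem DualModule.toDual_smul (φ : DualModule K A) (a : Aᵐᵒᵖ) (b : A) :
    toDual (a • φ) b = toDual φ (a.unop * b) := rfl

variable (K) in
/-- The right module `D(A)` is injective. -/
theorem injective_dualModule (A : Type (max u v)) [Ring A] [Algebra K A] :
    Injective (ModuleCat.of Aᵐᵒᵖ (DualModule K A)) := by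
  refine (Module.injective_iff_injective_object _ _).1 (Module.Baer.injective fun I g => ?_)
  -- A homomorphism into `D(A)` is determined by the linear form "evaluate at `1`". Extending this
  -- form `K`-linearly from `I` to the whole ring solves Baer's extension problem.
  let ev : I.restrictScalars K →ₗ[K] K :=
    { toFun x := DualModule.toDual (g ⟨x, x.2⟩) 1
      map_add' x y := by
        have : (⟨(x + y : I.restrictScalars K), (x + y).2⟩ : I) = ⟨x, x.2⟩ + ⟨y, y.2⟩ := rfl
        rw [this, map_add, map_add, LinearMap.add_apply]
      map_smul' k x := by
        have : (⟨(k • x : I.restrictScalars K), (k • x).2⟩ : I) =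
            (op (algebraMap K A k) : Aᵐᵒᵖ) • ⟨x, x.2⟩ :=
          Subtype.ext (Algebra.smul_def k (x : Aᵐᵒᵖ))
        rw [this, map_smul, DualModule.toDual_smul, mul_one, unop_op,
          Algebra.algebraMap_eq_smul_one, map_smul]
        rfl }
  obtain ⟨e, he⟩ := LinearMap.exists_extend ev
  refine ⟨LinearMap.toSpanSingleton Aᵐᵒᵖ (DualModule K A)
    (show Module.Dual K A from e ∘ₗ (opLinearEquiv K : A ≃ₗ[K] Aᵐᵒᵖ).toLinearMap),
    fun x hx => DualModule.ext fun b => ?_⟩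
  refine (LinearMap.congr_fun he ⟨op b * x, I.mul_mem_left _ hx⟩).trans ?_
  have : (⟨op b * x, I.mul_mem_left _ hx⟩ : I) = op b • ⟨x, hx⟩ := rfl
  change DualModule.toDual (g ⟨op b * x, I.mul_mem_left _ hx⟩) 1 = _
  rw [this, map_smul, DualModule.toDual_smul, mul_one, unop_op]

end RightModule

/-! ### Modules of row vectors supported on convex sets. -/

namespace IncidenceAlgebra

section Poset

variable (K : Type u) {L : Type v} [Field K] [PartialOrder L]

/-- The functions on a poset with values in `K` that vanish outside `C`. -/
@[ext] structure ConvexModule (C : Set L) : Type (max u v) where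
  /-- The underlying function. -/
  toFun : L → K
  eq_zero_of_notMem' : ∀ b, b ∉ C → toFun b = 0

namespace ConvexModule

variable {K} {C D : Set L}

instance : CoeFun (ConvexModule K C) fun _ => L → K := ⟨toFun⟩

theorem eq_zero_of_notMem (v : ConvexModule K C) {b : L} (hb : b ∉ C) : v b = 0 :=
  v.eq_zero_of_notMem' b hb

theorem ext_of_mem {v w : ConvexModule K C} (h : ∀ b ∈ C, v b = w b) : v = w :=
  ConvexModule.ext <| funext fun b => by
    by_cases hb : b ∈ C
    · exact h b hb
    · rw [v.eq_zero_of_notMem hb, w.eq_zero_of_notMem hb]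

variable (K C) in
/-- The functions vanishing outside `C` as a subgroup of all functions. -/
def addSubgroup : AddSubgroup (L → K) where
  carrier := {v | ∀ b, b ∉ C → v b = 0}
  zero_mem' _ _ := rfl
  add_mem' hv hw b hb := by simp [hv b hb, hw b hb]
  neg_mem' hv b hb := by simp [hv b hb]

variable (K C) in
/-- The two descriptions of the functions vanishing outside `C`. -/
def equivAddSubgroup : ConvexModule K C ≃ addSubgroup K C where
  toFun v := ⟨v.toFun, v.eq_zero_of_notMem'⟩
  invFun v := ⟨v.1, v.2⟩

instance : AddCommGroup (ConvexModule K C) := (equivAddSubgroup K C).addCommGroup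

@[simp] theorem zero_apply (b : L) : (0 : ConvexModule K C) b = 0 := rfl
@[simp] theorem add_apply (v w : ConvexModule K C) (b : L) : (v + w) b = v b + w b := rfl

variable [LocallyFiniteOrder L] [DecidableEq L] [Fintype L]

theorem _root_.IncidenceAlgebra.mul_apply_univ (f g : IncidenceAlgebra K L) (a b : L) :
    (f * g) a b = ∑ c, f a c * g c b := by
  rw [mul_apply]
  refine Finset.sum_subset (Finset.subset_univ _) fun c _ hc => ?_
  rw [Finset.mem_Icc, not_and_or] at hc
  obtain h | h := hc
  · rw [apply_eq_zero_of_not_le h, zero_mul]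
  · rw [apply_eq_zero_of_not_le h, mul_zero]

open Classical in
noncomputable instance : SMul (IncidenceAlgebra K L)ᵐᵒᵖ (ConvexModule K C) where
  smul f v := ⟨fun b => if b ∈ C then ∑ a, v a * f.unop a b else 0, fun _ hb => if_neg hb⟩

theorem smul_apply (f : (IncidenceAlgebra K L)ᵐᵒᵖ) (v : ConvexModule K C) {b : L} (hb : b ∈ C) :
    (f • v) b = ∑ a, v a * f.unop a b := if_pos hb

/-- Row vectors supported on the convex set `C`, a right module over the incidence algebra by
multiplication of a row vector with a matrix and restriction of the result to `C`. -/
noncomputable instance [hC : C.OrdConnected] :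
    Module (IncidenceAlgebra K L)ᵐᵒᵖ (ConvexModule K C) where
  one_smul v := by
    refine ext_of_mem fun b hb => ?_
    simp [smul_apply _ _ hb]
  mul_smul f g v := by
    refine ext_of_mem fun b hb => ?_
    simp only [smul_apply _ _ hb, unop_mul, mul_apply_univ, Finset.mul_sum]
    rw [Finset.sum_comm]
    refine Finset.sum_congr rfl fun c _ => ?_
    by_cases hc : c ∈ C
    · simp only [smul_apply _ _ hc, Finset.sum_mul, mul_assoc]
    · rw [(g • v).eq_zero_of_notMem hc, zero_mul]
      refine Finset.sum_eq_zero fun a _ => ?_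
      by_cases ha : a ∈ C
      · by_cases hac : a ≤ c
        · have : ¬ c ≤ b := fun hcb => hc (hC.out ha hb ⟨hac, hcb⟩)
          rw [apply_eq_zero_of_not_le this, mul_zero, mul_zero]
        · rw [apply_eq_zero_of_not_le hac, zero_mul, mul_zero]
      · rw [v.eq_zero_of_notMem ha, zero_mul]
  smul_zero f := by
    refine ext_of_mem fun b hb => ?_
    simp [smul_apply _ _ hb]
  smul_add f v w := by
    refine ext_of_mem fun b hb => ?_
    simp [smul_apply _ _ hb, add_mul, Finset.sum_add_distrib]
  add_smul f g v := by
    refine ext_of_mem fun b hb => ?_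
    simp [smul_apply _ _ hb, mul_add, Finset.sum_add_distrib]
  zero_smul v := by
    refine ext_of_mem fun b hb => ?_
    simp [smul_apply _ _ hb]

theorem smul_one_smul_apply [C.OrdConnected] (k : K) (v : ConvexModule K C) (b : L) :
    (op (k • (1 : IncidenceAlgebra K L)) • v) b = k * v b := by
  by_cases hb : b ∈ C
  · simp [smul_apply _ _ hb, mul_comm k]
  · rw [eq_zero_of_notMem _ hb, eq_zero_of_notMem _ hb, mul_zero]

open Classical in
/-- Restriction of functions from `C` to `C ∩ D`, extension by zero to `D`, and multiplication by
the scalar `k`. -/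
noncomputable def map [C.OrdConnected] [D.OrdConnected] (k : K)
    (h₁ : ∀ a ∈ C, a ∈ D → ∀ b ∈ D, a ≤ b → b ∈ C)
    (h₂ : ∀ a ∈ C, ∀ b ∈ C, b ∈ D → a ≤ b → a ∈ D) :
    ConvexModule K C →ₗ[(IncidenceAlgebra K L)ᵐᵒᵖ] ConvexModule K D where
  toFun v := ⟨fun b => if b ∈ D then k * v b else 0, fun _ hb => if_neg hb⟩
  map_add' v w := by
    refine ext_of_mem fun b hb => ?_
    simp [hb, mul_add]
  map_smul' f v := by
    refine ext_of_mem fun b hb => ?_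
    simp only [RingHom.id_apply, smul_apply _ _ hb, if_pos hb]
    by_cases hbC : b ∈ C
    · rw [smul_apply _ _ hbC, Finset.mul_sum]
      refine Finset.sum_congr rfl fun a _ => ?_
      split_ifs with ha
      · rw [mul_assoc]
      · rw [zero_mul]
        by_cases haC : a ∈ C
        · rw [apply_eq_zero_of_not_le fun hab => ha (h₂ a haC b hbC hb hab), mul_zero, mul_zero]
        · rw [v.eq_zero_of_notMem haC, zero_mul, mul_zero]
    · rw [(f • v).eq_zero_of_notMem hbC, mul_zero]
      refine (Finset.sum_eq_zero fun a _ => ?_).symm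
      split_ifs with ha
      · by_cases haC : a ∈ C
        · rw [apply_eq_zero_of_not_le fun hab => hbC (h₁ a haC ha b hb hab), mul_zero]
        · rw [v.eq_zero_of_notMem haC, mul_zero, zero_mul]
      · rw [zero_mul]

theorem map_apply [C.OrdConnected] [D.OrdConnected] (k : K) (h₁ h₂) (v : ConvexModule K C) {b : L}
    (hb : b ∈ D) : map (D := D) k h₁ h₂ v b = k * v b := if_pos hb

open Classical in
variable (K C) in
/-- The characteristic function of `{a} ∩ C`. -/
noncomputable def single (a : L) : ConvexModule K C :=
  ⟨fun b => if b = a ∧ a ∈ C then 1 else 0, fun b hb => if_neg fun h => hb (by rw [h.1]; exact h.2)⟩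

theorem single_self {a : L} (ha : a ∈ C) : single K C a a = 1 := if_pos ⟨rfl, ha⟩

theorem single_of_ne {a b : L} (h : b ≠ a) : single K C a b = 0 := if_neg fun hh => h hh.1

theorem single_eq_zero {a : L} (ha : a ∉ C) : single K C a = 0 := by
  refine ext_of_mem fun b hb => ?_
  exact if_neg fun h => ha h.2

open Classical in
variable (K) in
/-- The basis element of the incidence algebra that is `1` at `(a, b)` and zero elsewhere. It is
zero unless `a ≤ b`. -/
noncomputable def _root_.IncidenceAlgebra.basisElem (a b : L) : IncidenceAlgebra K L where
  toFun c d := if c = a ∧ d = b ∧ c ≤ d then 1 else 0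
  eq_zero_of_not_le' _ _ hcd := if_neg fun h => hcd h.2.2

theorem _root_.IncidenceAlgebra.basisElem_apply (a b : L) {c d : L} (hcd : c ≤ d) :
    basisElem K a b c d = if c = a ∧ d = b then 1 else 0 := by
  simp [basisElem, hcd]

theorem _root_.IncidenceAlgebra.basisElem_apply_of_ne_left {a b c d : L} (h : c ≠ a) :
    basisElem K a b c d = 0 := by
  simp [basisElem, h]

theorem _root_.IncidenceAlgebra.basisElem_apply_of_ne_right {a b c d : L} (h : d ≠ b) :
    basisElem K a b c d = 0 := by
  simp [basisElem, h]

theorem _root_.IncidenceAlgebra.basisElem_eq_zero {a b : L} (h : ¬ a ≤ b) :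
    basisElem K a b = 0 := by
  ext c d hcd
  rw [basisElem_apply _ _ hcd, if_neg, IncidenceAlgebra.zero_apply]
  rintro ⟨rfl, rfl⟩
  exact h hcd

theorem _root_.IncidenceAlgebra.sum_apply {ι : Type*} (s : Finset ι)
    (f : ι → IncidenceAlgebra K L) (a b : L) : (∑ i ∈ s, f i) a b = ∑ i ∈ s, f i a b :=
  map_sum (⟨⟨fun f => f a b, rfl⟩, fun _ _ => rfl⟩ : IncidenceAlgebra K L →+ K) f s

theorem _root_.IncidenceAlgebra.mul_basisElem (f : IncidenceAlgebra K L) {a b : L} (hba : b ≤ a) :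
    f * basisElem K b a = ∑ c, f c b • basisElem K c a := by
  ext x y hxy
  rw [mul_apply_univ, sum_apply]
  simp only [constSMul_apply, basisElem_apply _ _ hxy, smul_eq_mul]
  rw [Finset.sum_eq_single b, Finset.sum_eq_single x]
  · by_cases hy : y = a
    · subst hy
      simp [basisElem_apply _ _ hba]
    · have : basisElem K b a b y = 0 := basisElem_apply_of_ne_right hy
      simp [this, hy]
  · intro c _ hc
    simp [hc.symm]
  · simp
  · intro c _ hc
    have : basisElem K b a c y = 0 := basisElem_apply_of_ne_left hc
    rw [this, mul_zero]
  · simp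

theorem _root_.IncidenceAlgebra.sum_smul_basisElem (f : IncidenceAlgebra K L) :
    ∑ a, ∑ b, f b a • basisElem K b a = f := by
  ext x y hxy
  simp only [sum_apply, constSMul_apply, basisElem_apply _ _ hxy, smul_eq_mul]
  rw [Finset.sum_eq_single y, Finset.sum_eq_single x]
  · simp
  · intro c _ hc
    simp [hc.symm]
  · simp
  · intro c _ hc
    simp [hc.symm]
  · simp

theorem basisElem_smul [C.OrdConnected] {a b : L} (hab : a ≤ b) (v : ConvexModule K C) :
    op (basisElem K a b) • v = op (v a • (1 : IncidenceAlgebra K L)) • single K C b := by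
  refine ext_of_mem fun c hc => ?_
  rw [smul_one_smul_apply, smul_apply _ _ hc, Finset.sum_eq_single a]
  · by_cases h : c = b
    · subst h
      simp [basisElem_apply _ _ hab, single_self hc]
    · have : basisElem K a b a c = 0 := basisElem_apply_of_ne_right h
      simp [this, single_of_ne h]
  · intro d _ hd
    have : basisElem K a b d c = 0 := basisElem_apply_of_ne_left hd
    simp [this]
  · simp

theorem basisElem_smul_apply [C.OrdConnected] {a b : L} (hab : a ≤ b) (v : ConvexModule K C)
    (hb : b ∈ C) : (op (basisElem K a b) • v) b = v a := by
  rw [basisElem_smul hab, smul_one_smul_apply, single_self hb, mul_one]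

/-- The matrix with `a`-th row `v` and all other rows zero. -/
noncomputable def rowMatrix {a : L} (hC : ∀ b ∈ C, a ≤ b) (v : ConvexModule K C) :
    IncidenceAlgebra K L where
  toFun c d := if c = a then v d else 0
  eq_zero_of_not_le' c d hcd := by
    split_ifs with h
    · subst h
      exact v.eq_zero_of_notMem fun hd => hcd (hC d hd)
    · rfl

theorem rowMatrix_apply {a : L} (hC : ∀ b ∈ C, a ≤ b) (v : ConvexModule K C) (c d : L) :
    rowMatrix hC v c d = if c = a then v d else 0 := rfl

/-- A homomorphism out of the module of functions on `{b | a ≤ b}` is multiplication by a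
scalar. -/
theorem exists_scalar_of_forall_ge [C.OrdConnected] [D.OrdConnected] {a : L}
    (hC : ∀ b, b ∈ C ↔ a ≤ b)
    (f : ConvexModule K C →ₗ[(IncidenceAlgebra K L)ᵐᵒᵖ] ConvexModule K D) :
    ∃ k : K, (a ∉ D → k = 0) ∧ ∀ v, ∀ b ∈ D, f v b = k * v b := by
  have ha : a ∈ C := (hC a).2 le_rfl
  refine ⟨f (single K C a) a, fun h => (f _).eq_zero_of_notMem h, fun v b hb => ?_⟩
  -- The characteristic function of the least element `a` generates the module, so its image
  -- determines `f`, and only the coordinate of that image at `a` matters.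
  have : v = op (rowMatrix (fun b => (hC b).1) v) • single K C a := by
    refine ext_of_mem fun d hd => ?_
    rw [smul_apply _ _ hd, Finset.sum_eq_single a] <;>
      simp +contextual [rowMatrix_apply, single_self ha]
  conv_lhs => rw [this, map_smul, smul_apply _ _ hb]
  simp [rowMatrix_apply]

/-- A homomorphism into the module of functions on `{b | b ≤ a}` is multiplication by a
scalar. -/
theorem exists_scalar_of_forall_le [C.OrdConnected] [D.OrdConnected] {a : L}
    (hD : ∀ b, b ∈ D ↔ b ≤ a)
    (f : ConvexModule K C →ₗ[(IncidenceAlgebra K L)ᵐᵒᵖ] ConvexModule K D) :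
    ∃ k : K, (a ∉ C → k = 0) ∧ ∀ v, ∀ b ∈ D, f v b = k * v b := by
  have ha : a ∈ D := (hD a).2 le_rfl
  refine ⟨f (single K C a) a, fun h => by simp [single_eq_zero h], fun v b hb => ?_⟩
  -- The coordinate at `b` is moved to the greatest element `a` by the matrix unit from `b` to `a`.
  -- Before applying `f`, this matrix unit turns `v` into `v b` times the characteristic function of
  -- `a`.
  have := basisElem_smul_apply ((hD b).1 hb) (f v) ha
  rw [← this, ← map_smul, basisElem_smul ((hD b).1 hb), map_smul, smul_one_smul_apply, mul_comm]

variable (K) in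
/-- The module of functions supported on the convex set `C`, as an object of the category of
right modules. -/
noncomputable abbrev obj (C : Set L) [C.OrdConnected] :
    ModuleCat.{max u v} (IncidenceAlgebra K L)ᵐᵒᵖ :=
  ModuleCat.of _ (ConvexModule K C)

/-! ### Exact sequences from splitting a convex set into an up-closed part and its complement. -/

section ShortExact

variable {U C Q : Set L} [U.OrdConnected] [C.OrdConnected] [Q.OrdConnected]
  (hC : ∀ b, b ∈ C ↔ b ∈ U ∨ b ∈ Q) (hd : ∀ b ∈ U, ∀ c ∈ Q, ¬ b ≤ c)

variable (K) in
/-- Extension by zero from `U` to `C = U ∪ Q`, where `U` is closed upwards in `C`. -/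
noncomputable def extend : ConvexModule K U →ₗ[(IncidenceAlgebra K L)ᵐᵒᵖ] ConvexModule K C :=
  map 1 (fun a ha _ b hb hab => ((hC b).1 hb).resolve_right fun h => hd a ha b h hab)
    (fun a ha _ _ _ _ => (hC a).2 (.inl ha))

variable (K) in
/-- Restriction from `C = U ∪ Q` to `Q`, where `U` is closed upwards in `C`. -/
noncomputable def restrict : ConvexModule K C →ₗ[(IncidenceAlgebra K L)ᵐᵒᵖ] ConvexModule K Q :=
  map 1 (fun _ _ _ b hb _ => (hC b).2 (.inr hb))
    (fun a ha _ _ hb hab => ((hC a).1 ha).resolve_left fun h => hd a h _ hb hab)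

theorem extend_apply (v : ConvexModule K U) {b : L} (hb : b ∈ C) :
    extend K hC hd v b = v b := by
  rw [extend, map_apply _ _ _ _ hb, one_mul]

theorem restrict_apply (v : ConvexModule K C) {b : L} (hb : b ∈ Q) :
    restrict K hC hd v b = v b := by
  rw [restrict, map_apply _ _ _ _ hb, one_mul]

variable (K) in
/-- The sequence of functions on `U`, on `C` and on `Q`, where `C` is the disjoint union of `U` and
`Q` with `U` closed upwards in `C`. -/
noncomputable abbrev shortComplex :
    ShortComplex (ModuleCat.{max u v} (IncidenceAlgebra K L)ᵐᵒᵖ) where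
  X₁ := obj K U
  X₂ := obj K C
  X₃ := obj K Q
  f := ModuleCat.ofHom (extend K hC hd)
  g := ModuleCat.ofHom (restrict K hC hd)
  zero := by
    refine ModuleCat.hom_ext (LinearMap.ext fun v =>
      ext_of_mem (K := K) (C := Q) fun b hb => ?_)
    refine (restrict_apply hC hd _ hb).trans ?_
    refine (extend_apply hC hd _ ((hC b).2 (.inr hb))).trans ?_
    exact eq_zero_of_notMem _ fun h => hd b h b hb le_rfl

theorem shortExact : (shortComplex K hC hd).ShortExact where
  exact := by
    rw [ShortComplex.moduleCat_exact_iff]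
    intro (v : ConvexModule K C) hv
    replace hv : ∀ b ∈ Q, v b = 0 := fun b hb => by
      rw [← restrict_apply hC hd v hb]
      exact congrArg (fun w : ConvexModule K Q => w b) hv
    refine ⟨(⟨v, fun b hb => ?_⟩ : ConvexModule K U), ?_⟩
    · by_cases hbQ : b ∈ Q
      · exact hv b hbQ
      · exact v.eq_zero_of_notMem fun h => ((hC b).1 h).elim hb hbQ
    · exact ext_of_mem fun b hb => extend_apply hC hd _ hb
  mono_f := by
    rw [ModuleCat.mono_iff_injective]
    intro (v : ConvexModule K U) (w : ConvexModule K U) h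
    refine ext_of_mem fun b hb => ?_
    have hb' := (hC b).2 (.inl hb)
    rw [← extend_apply hC hd v hb', ← extend_apply hC hd w hb']
    exact congrArg (fun w : ConvexModule K C => w b) h
  epi_g := by
    rw [ModuleCat.epi_iff_surjective]
    intro (v : ConvexModule K Q)
    refine ⟨(⟨v, fun b hb => v.eq_zero_of_notMem fun h => hb ((hC b).2 (.inr h))⟩ :
      ConvexModule K C), ?_⟩
    exact ext_of_mem fun b hb => restrict_apply hC hd _ hb

end ShortExact

/-! ### The indecomposable projective modules -/

/-- The `a`-th row, as a homomorphism from the regular module. -/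
noncomputable def row [C.OrdConnected] {a : L} (hC : ∀ b, b ∈ C ↔ a ≤ b) :
    IncidenceAlgebra K L →ₗ[(IncidenceAlgebra K L)ᵐᵒᵖ] ConvexModule K C where
  toFun f := ⟨f a, fun _ hb => apply_eq_zero_of_not_le (fun h => hb ((hC _).2 h)) f⟩
  map_add' _ _ := rfl
  map_smul' f g := by
    refine ext_of_mem fun b hb => ?_
    rw [RingHom.id_apply, smul_apply _ _ hb]
    exact mul_apply_univ _ _ _ _

/-- The inclusion of the `a`-th row into the regular module. -/
noncomputable def ofRow [C.OrdConnected] {a : L} (hC : ∀ b, b ∈ C ↔ a ≤ b) :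
    ConvexModule K C →ₗ[(IncidenceAlgebra K L)ᵐᵒᵖ] IncidenceAlgebra K L where
  toFun v := rowMatrix (fun b => (hC b).1) v
  map_add' v w := by
    ext c d
    rw [IncidenceAlgebra.add_apply]
    simp only [rowMatrix_apply]
    split_ifs <;> simp
  map_smul' f v := by
    ext c d hcd
    change _ = (rowMatrix _ v * f.unop) c d
    rw [mul_apply_univ]
    simp only [rowMatrix_apply]
    split_ifs with h
    · exact smul_apply _ _ ((hC d).2 (h ▸ hcd))
    · simp

theorem ofRow_apply [C.OrdConnected] {a : L} (hC : ∀ b, b ∈ C ↔ a ≤ b) (v : ConvexModule K C)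
    (c d : L) : ofRow hC v c d = if c = a then v d else 0 := rfl

/-- The functions on `{b | a ≤ b}` are a direct summand of the regular module. -/
noncomputable def retractRegular [C.OrdConnected] {a : L} (hC : ∀ b, b ∈ C ↔ a ≤ b) :
    Retract (obj K C) (ModuleCat.of (IncidenceAlgebra K L)ᵐᵒᵖ (IncidenceAlgebra K L)) where
  i := ModuleCat.ofHom (ofRow hC)
  r := ModuleCat.ofHom (row hC)
  retract := by
    refine ModuleCat.hom_ext (LinearMap.ext fun v => ext_of_mem (C := C) fun b _ => ?_)
    exact if_pos rfl

theorem projective_of_forall_ge [C.OrdConnected] {a : L} (hC : ∀ b, b ∈ C ↔ a ≤ b) :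
    Projective (obj K C) := by
  have : Module.Projective (IncidenceAlgebra K L)ᵐᵒᵖ (IncidenceAlgebra K L) :=
    .of_equiv (opLinearEquiv (IncidenceAlgebra K L)ᵐᵒᵖ).symm
  have : Projective (ModuleCat.of (IncidenceAlgebra K L)ᵐᵒᵖ (IncidenceAlgebra K L)) :=
    inferInstance
  exact (retractRegular hC).projective

/-- A matrix is the sum of its rows. This lets Ext vanishing into each `P_a` pass to Ext vanishing
into `A`. -/
theorem sum_row_comp_ofRow (C : L → Set L) [∀ a, (C a).OrdConnected]
    (hC : ∀ a b, b ∈ C a ↔ a ≤ b) :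
    ∑ a, ModuleCat.ofHom (row (K := K) (hC a)) ≫ ModuleCat.ofHom (ofRow (hC a)) = 𝟙 _ := by
  refine ModuleCat.hom_ext (LinearMap.ext fun f => ?_)
  rw [ModuleCat.hom_sum, LinearMap.sum_apply]
  refine IncidenceAlgebra.ext fun c d _ => (IncidenceAlgebra.sum_apply _ _ c d).trans ?_
  refine (Finset.sum_congr rfl fun a _ => ofRow_apply (hC a) _ c d).trans ?_
  rw [Finset.sum_ite_eq, if_pos (Finset.mem_univ _)]
  rfl

/-! ### The indecomposable injective modules -/

/-- The pairing of the elements of `D(A)` with the `a`-th column. -/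
noncomputable def column [C.OrdConnected] {a : L} (hC : ∀ b, b ∈ C ↔ b ≤ a) :
    RightModule.DualModule K (IncidenceAlgebra K L) →ₗ[(IncidenceAlgebra K L)ᵐᵒᵖ]
      ConvexModule K C where
  toFun φ := ⟨fun b => RightModule.DualModule.toDual φ
    (basisElem K b a), fun b hb => by
      rw [basisElem_eq_zero fun h => hb ((hC b).2 h), map_zero]⟩
  map_add' φ ψ := rfl
  map_smul' f φ := by
    refine ext_of_mem fun b hb => ?_
    rw [RingHom.id_apply, smul_apply _ _ hb]
    change RightModule.DualModule.toDual φ (f.unop * _) = _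
    rw [mul_basisElem _ ((hC b).1 hb), map_sum]
    refine Finset.sum_congr rfl fun c _ => ?_
    rw [map_smul, smul_eq_mul, mul_comm]

/-- The functions on `{b | b ≤ a}` as linear forms depending only on the `a`-th column. -/
noncomputable def ofColumn [C.OrdConnected] {a : L} (hC : ∀ b, b ∈ C ↔ b ≤ a) :
    ConvexModule K C →ₗ[(IncidenceAlgebra K L)ᵐᵒᵖ]
      RightModule.DualModule K (IncidenceAlgebra K L) where
  toFun v :=
    { toFun f := ∑ b, v b * f b a
      map_add' f g := by simp [mul_add, Finset.sum_add_distrib]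
      map_smul' k f := by simp [constSMul_apply, Finset.mul_sum, mul_left_comm] }
  map_add' v w := by
    refine LinearMap.ext fun f => ?_
    change ∑ b, (v + w) b * f b a = ∑ b, v b * f b a + ∑ b, w b * f b a
    simp [add_mul, Finset.sum_add_distrib]
  map_smul' f v := by
    refine LinearMap.ext fun g => ?_
    change ∑ b, (f • v) b * g b a = ∑ b, v b * (f.unop * g) b a
    have (b : L) : (f • v) b * g b a = ∑ c, v c * (f.unop c b * g b a) := by
      by_cases hb : b ∈ C
      · simp [smul_apply _ _ hb, Finset.sum_mul, mul_assoc]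
      · simp [apply_eq_zero_of_not_le fun h => hb ((hC b).2 h)]
    simp only [this, mul_apply_univ, Finset.mul_sum]
    exact Finset.sum_comm

theorem ofColumn_apply [C.OrdConnected] {a : L} (hC : ∀ b, b ∈ C ↔ b ≤ a) (v : ConvexModule K C)
    (f : IncidenceAlgebra K L) :
    RightModule.DualModule.toDual (ofColumn hC v) f =
      ∑ b, v b * f b a := rfl

/-- The functions on `{b | b ≤ a}` are a direct summand of `D(A)`. -/
noncomputable def retractDual [C.OrdConnected] {a : L} (hC : ∀ b, b ∈ C ↔ b ≤ a) :
    Retract (obj K C) (ModuleCat.of (IncidenceAlgebra K L)ᵐᵒᵖ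
      (RightModule.DualModule K (IncidenceAlgebra K L))) where
  i := ModuleCat.ofHom (ofColumn hC)
  r := ModuleCat.ofHom (column hC)
  retract := by
    refine ModuleCat.hom_ext (LinearMap.ext fun (v : ConvexModule K C) =>
      ext_of_mem (C := C) fun b hb => (ofColumn_apply hC v _).trans ?_)
    have h := (hC b).1 hb
    rw [Finset.sum_eq_single b, basisElem_apply _ _ h, if_pos ⟨rfl, rfl⟩, mul_one]
    · rfl
    · intro c _ hc
      have : basisElem K b a c a = 0 := basisElem_apply_of_ne_left hc
      rw [this, mul_zero]
    · simp

theorem sum_column_comp_ofColumn (C : L → Set L) [∀ a, (C a).OrdConnected]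
    (hC : ∀ a b, b ∈ C a ↔ b ≤ a) :
    ∑ a, ModuleCat.ofHom (column (K := K) (hC a)) ≫ ModuleCat.ofHom (ofColumn (hC a)) = 𝟙 _ := by
  refine ModuleCat.hom_ext (LinearMap.ext fun φ => ?_)
  rw [ModuleCat.hom_sum, LinearMap.sum_apply]
  refine RightModule.DualModule.ext fun f => ?_
  rw [map_sum, LinearMap.sum_apply]
  refine (Finset.sum_congr rfl fun a _ => ofColumn_apply (hC a) _ f).trans ?_
  -- A linear form is recovered from its values on the matrix units, grouped here by column.
  conv_rhs => rw [← sum_smul_basisElem f]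
  change _ = RightModule.DualModule.toDual φ _
  simp only [map_sum, map_smul, smul_eq_mul]
  exact Finset.sum_congr rfl fun a _ => Finset.sum_congr rfl fun b _ =>
    mul_comm _ (f b a)

theorem injective_of_forall_le [C.OrdConnected] {a : L} (hC : ∀ b, b ∈ C ↔ b ≤ a) :
    Injective (obj K C) := by
  have := RightModule.injective_dualModule K (IncidenceAlgebra K L)
  exact (retractDual hC).injective

end ConvexModule
end Poset
end IncidenceAlgebra

namespace IncidenceAlgebra

open Abelian ConvexModule

/-! ### Filters and ideals with finitely many smaller ones removed. -/

section PartialOrder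

variable {L : Type v} [PartialOrder L]

/-- The elements above `a` and not above any element of `T`. -/
def upperPart (a : L) (T : Finset L) : Set L := {b | a ≤ b ∧ ∀ t ∈ T, ¬ t ≤ b}

/-- The elements below `a` and not below any element of `T`. -/
def lowerPart (a : L) (T : Finset L) : Set L := {b | b ≤ a ∧ ∀ t ∈ T, ¬ b ≤ t}

instance (a : L) (T : Finset L) : (upperPart a T).OrdConnected :=
  ⟨fun _ hb _ hc _ hd => ⟨hb.1.trans hd.1, fun t ht h => hc.2 t ht (h.trans hd.2)⟩⟩

instance (a : L) (T : Finset L) : (lowerPart a T).OrdConnected :=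
  ⟨fun _ hb _ hc _ hd => ⟨hd.2.trans hc.1, fun t ht h => hb.2 t ht (hd.1.trans h)⟩⟩

theorem mem_upperPart_empty (a b : L) : b ∈ upperPart a ∅ ↔ a ≤ b := by simp [upperPart]

theorem mem_lowerPart_empty (a b : L) : b ∈ lowerPart a ∅ ↔ b ≤ a := by simp [lowerPart]

end PartialOrder

variable (K : Type u) {L : Type v} [Field K] [Lattice L] [LocallyFiniteOrder L] [DecidableEq L]
  [Fintype L]

/-! ### Projective resolutions and Ext into `P_z`. -/

section Upper

/-- Elements are sorted by whether they lie above `y`. Those that do again form a truncated filter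
because the lattice has joins, which is what makes induction on `T` possible. -/
theorem mem_upperPart_insert (a y : L) (T : Finset L) (b : L) :
    b ∈ upperPart a T ↔ b ∈ upperPart (a ⊔ y) T ∨ b ∈ upperPart a (insert y T) := by
  simp only [upperPart, Set.mem_ofPred_eq, sup_le_iff, Finset.forall_mem_insert]
  tauto

theorem not_le_of_mem_upperPart (a y : L) (T : Finset L) :
    ∀ b ∈ upperPart (a ⊔ y) T, ∀ c ∈ upperPart a (insert y T), ¬ b ≤ c := fun _ hb _ hc h =>
  hc.2 y (Finset.mem_insert_self y T) (le_sup_right.trans (hb.1.trans h))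

/-- The short exact sequence that adds an element `y` to `T`. -/
theorem upperPart_shortExact (a y : L) (T : Finset L) :
    (shortComplex K (mem_upperPart_insert a y T) (not_le_of_mem_upperPart a y T)).ShortExact :=
  shortExact _ _

instance (a : L) : Projective (obj K (upperPart a ∅)) :=
  projective_of_forall_ge (mem_upperPart_empty a)

/-- Each element added to `T` raises the bound by at most one. The base point must vary, since the
submodule in the sequence starts at `a ⊔ y`. -/
theorem hasProjectiveDimensionLT_upperPart (T : Finset L) (a : L) :
    HasProjectiveDimensionLT (obj K (upperPart a T)) (T.card + 1) := by
  induction T using Finset.induction_on generalizing a with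
  | empty => exact inferInstanceAs (HasProjectiveDimensionLT (obj K (upperPart a ∅)) 1)
  | insert y T hy ih =>
    rw [Finset.card_insert_of_notMem hy]
    have := ih a
    exact (upperPart_shortExact K a y T).hasProjectiveDimensionLT_X₃ (T.card + 1) (ih (a ⊔ y))
      (hasProjectiveDimensionLT_of_ge _ (T.card + 1) _ (Nat.le_succ _))

theorem hom_upperPart_eq_zero {a z : L} (h : ¬ z ≤ a)
    (f : obj K (upperPart a ∅) ⟶ obj K (upperPart z ∅)) : f = 0 := by
  obtain ⟨k, hk, hf⟩ := exists_scalar_of_forall_ge (mem_upperPart_empty a) f.hom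
  rw [hk fun hz => h ((mem_upperPart_empty z a).1 hz)] at hf
  refine ModuleCat.hom_ext (LinearMap.ext fun v =>
    ext_of_mem (K := K) (C := upperPart z ∅) fun b hb => (hf v b hb).trans (zero_mul _))

/-- All joins of `a` with elements of `T` stay below `u`, hence none is above `z`: every projective
in the resolution has zero Hom to `P_z`. -/
theorem subsingleton_ext_upperPart_of_le {z u : L} (hz : ¬ z ≤ u) (T : Finset L) {a : L}
    (ha : a ≤ u) (hT : ∀ t ∈ T, t ≤ u) (n : ℕ) :
    Subsingleton (Ext (obj K (upperPart a T)) (obj K (upperPart z ∅)) n) := by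
  induction T using Finset.induction_on generalizing a n with
  | empty =>
    cases n with
    | zero =>
      refine subsingleton_of_forall_eq 0 fun e => ?_
      obtain ⟨f, rfl⟩ := (Ext.mk₀_bijective _ _).2 e
      rw [hom_upperPart_eq_zero K (fun h => hz (h.trans ha)) f, Ext.mk₀_zero]
    | succ n => exact HasProjectiveDimensionLT.subsingleton _ 1 _ (by lia) _
  | insert y T hy ih =>
    rw [Finset.forall_mem_insert] at hT
    exact (upperPart_shortExact K a y T).subsingleton_ext_X₃ (ih (sup_le ha hT.1) hT.2)
      (ih ha hT.2) n

variable {K} in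
/-- Multiplication by a scalar, between the functions on two principal filters. -/
noncomputable def filterScalar {z a : L} (h : z ≤ a) (k : K) :
    ConvexModule K (upperPart a ∅) →ₗ[(IncidenceAlgebra K L)ᵐᵒᵖ] ConvexModule K (upperPart z ∅) :=
  map k (fun b hb _ c _ hbc =>
    (mem_upperPart_empty a c).2 (((mem_upperPart_empty a b).1 hb).trans hbc))
    (fun b hb _ _ _ _ => (mem_upperPart_empty z b).2 (h.trans ((mem_upperPart_empty a b).1 hb)))

variable {K} in
theorem filterScalar_apply {z a : L} (h : z ≤ a) (k : K) (v : ConvexModule K (upperPart a ∅))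
    {b : L} (hb : b ∈ upperPart z ∅) : filterScalar h k v b = k * v b := by
  rw [filterScalar, map_apply _ _ _ _ hb]

/-- Under `h`, either both Hom spaces are copies of `K` and restriction preserves the scalar, or
both are zero. -/
theorem bijective_comp_upperPart {z a y : L} (h : z ≤ a ⊔ y → z ≤ a) :
    Function.Bijective fun f : obj K (upperPart a ∅) ⟶ obj K (upperPart z ∅) =>
      ModuleCat.ofHom (extend K (mem_upperPart_insert a y ∅) (not_le_of_mem_upperPart a y ∅)) ≫
        f := by
  by_cases hza : z ≤ a
  · have hy : a ⊔ y ∈ upperPart (a ⊔ y) ∅ := (mem_upperPart_empty _ _).2 le_rfl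
    have hyz : a ⊔ y ∈ upperPart z ∅ := (mem_upperPart_empty _ _).2 (hza.trans le_sup_left)
    have hya : a ⊔ y ∈ upperPart a ∅ := (mem_upperPart_empty _ _).2 le_sup_left
    constructor
    · refine (injective_iff_map_eq_zero (Preadditive.leftComp _ (ModuleCat.ofHom _))).2
        fun f hf => ?_
      obtain ⟨k, -, hk⟩ := exists_scalar_of_forall_ge (mem_upperPart_empty a) f.hom
      have h0 := hk (extend K (mem_upperPart_insert a y ∅) (not_le_of_mem_upperPart a y ∅)
        (single K _ (a ⊔ y))) _ hyz
      rw [extend_apply _ _ _ hya, single_self hy, mul_one] at h0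
      have : k = 0 := h0.symm.trans
        (congrArg (fun g => ConvexModule.toFun (C := upperPart z ∅)
          (g.hom (single K (upperPart (a ⊔ y) ∅) (a ⊔ y))) (a ⊔ y)) hf)
      subst this
      exact ModuleCat.hom_ext (LinearMap.ext fun v =>
        ext_of_mem (K := K) (C := upperPart z ∅) fun b hb => (hk v b hb).trans (zero_mul _))
    · intro g
      obtain ⟨k, -, hk⟩ := exists_scalar_of_forall_ge (mem_upperPart_empty (a ⊔ y)) g.hom
      refine ⟨ModuleCat.ofHom (filterScalar hza k), ?_⟩
      · refine ModuleCat.hom_ext (LinearMap.ext fun v =>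
          ext_of_mem (K := K) (C := upperPart z ∅) fun b hb =>
            (filterScalar_apply hza k _ hb).trans ?_)
        refine Eq.trans ?_ (hk v b hb).symm
        by_cases hba : b ∈ upperPart a ∅
        · exact congrArg _ (extend_apply (mem_upperPart_insert a y ∅)
            (not_le_of_mem_upperPart a y ∅) v hba)
        · rw [eq_zero_of_notMem _ hba, eq_zero_of_notMem v fun hb' => hba
            ((mem_upperPart_insert a y ∅ b).2 (.inl hb'))]
  · have : Subsingleton (obj K (upperPart a ∅) ⟶ obj K (upperPart z ∅)) :=
      subsingleton_of_forall_eq 0 (hom_upperPart_eq_zero K hza)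
    exact ⟨Function.injective_of_subsingleton _, fun g =>
      ⟨0, (Limits.comp_zero).trans (hom_upperPart_eq_zero K (fun hz => hza (h hz)) g).symm⟩⟩

/-- Resolving along `T` while keeping `y` leaves cokernels of `P_(c ⊔ y) → P_c` with `a ≤ c`. On
each of them Ext vanishes, as Hom into `P_z` does not see the difference between `c` and `c ⊔ y`. -/
theorem subsingleton_ext_upperPart_insert {z y : L} (T : Finset L) {a : L}
    (h : ∀ c, a ≤ c → z ≤ c ⊔ y → z ≤ c) (n : ℕ) :
    Subsingleton (Ext (obj K (upperPart a (insert y T))) (obj K (upperPart z ∅)) n) := by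
  induction T using Finset.induction_on generalizing a n with
  | empty =>
    exact (upperPart_shortExact K a y ∅).subsingleton_ext_X₃_of_bijective
      (bijective_comp_upperPart K (h a le_rfl)) n
  | insert t T ht ih =>
    rw [Finset.insert_comm]
    exact (upperPart_shortExact K a t (insert y T)).subsingleton_ext_X₃
      (ih fun c hc => h c (le_sup_left.trans hc)) (ih h) n

/-- The witness `u` for `y` kills all Ext of the middle term, so degree and cardinality drop
together. The witnesses for the other elements of `T` lie above `y`, hence above the new base point
`a ⊔ y`. -/
theorem subsingleton_ext_upperPart_of_lt_card {z : L} (T : Finset L) {a : L}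
    (h : ∀ y ∈ T, ∃ u, a ≤ u ∧ (∀ t ∈ T, t ≠ y → t ≤ u) ∧ ¬ z ≤ u) {n : ℕ} (hn : n < T.card) :
    Subsingleton (Ext (obj K (upperPart a T)) (obj K (upperPart z ∅)) n) := by
  induction T using Finset.induction_on generalizing a n with
  | empty => simp at hn
  | insert y T hy ih =>
    obtain ⟨u, hau, hTu, hzu⟩ := h y (Finset.mem_insert_self y T)
    have hT := subsingleton_ext_upperPart_of_le K hzu T hau fun t ht =>
      hTu t (Finset.mem_insert_of_mem ht) fun h => hy (h ▸ ht)
    rw [Finset.card_insert_of_notMem hy] at hn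
    cases n with
    | zero => exact (upperPart_shortExact K a y T).subsingleton_ext_X₃_zero (hT 0)
    | succ n =>
      refine (upperPart_shortExact K a y T).subsingleton_ext_X₃_succ (ih (fun t ht => ?_)
        (by lia)) (hT _)
      obtain ⟨w, haw, hTw, hzw⟩ := h t (Finset.mem_insert_of_mem ht)
      exact ⟨w, sup_le haw (hTw y (Finset.mem_insert_self y T) fun h => hy (h ▸ ht)),
        fun s hs => hTw s (Finset.mem_insert_of_mem hs), hzw⟩

/-- The same shift is injective on Ext and ends, after absorbing all of `T` into the base point, at
a nonzero homomorphism between projectives; `hz` supplies the inequality that it needs. -/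
theorem nontrivial_ext_upperPart_card {z : L} (T : Finset L) {a : L}
    (h : ∀ y ∈ T, ∃ u, a ≤ u ∧ (∀ t ∈ T, t ≠ y → t ≤ u) ∧ ¬ z ≤ u)
    (hz : ∀ u, a ≤ u → (∀ t ∈ T, t ≤ u) → z ≤ u) :
    Nontrivial (Ext (obj K (upperPart a T)) (obj K (upperPart z ∅)) T.card) := by
  induction T using Finset.induction_on generalizing a with
  | empty =>
    have hza : z ≤ a := hz a le_rfl (by simp)
    rw [Finset.card_empty]
    refine ⟨Ext.mk₀ (ModuleCat.ofHom (filterScalar hza 1)), 0, fun h0 => ?_⟩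
    · rw [Ext.mk₀_eq_zero_iff] at h0
      have := congrArg (fun g => ConvexModule.toFun (C := upperPart z ∅)
        (g.hom (single K (upperPart a ∅) a)) a) h0
      refine one_ne_zero (α := K) (Eq.trans ?_ this)
      refine Eq.trans ?_ (filterScalar_apply hza 1 _ ((mem_upperPart_empty _ _).2 hza)).symm
      rw [single_self ((mem_upperPart_empty _ _).2 le_rfl), mul_one]
  | insert y T hy ih =>
    obtain ⟨u, hau, hTu, hzu⟩ := h y (Finset.mem_insert_self y T)
    have hT := subsingleton_ext_upperPart_of_le K hzu T hau fun t ht =>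
      hTu t (Finset.mem_insert_of_mem ht) fun h => hy (h ▸ ht)
    rw [Finset.card_insert_of_notMem hy]
    refine (upperPart_shortExact K a y T).nontrivial_ext_X₃_succ
      (ih (fun t ht => ?_) fun w haw hTw => ?_) (hT _)
    · obtain ⟨w, haw, hTw, hzw⟩ := h t (Finset.mem_insert_of_mem ht)
      exact ⟨w, sup_le haw (hTw y (Finset.mem_insert_self y T) fun h => hy (h ▸ ht)),
        fun s hs => hTw s (Finset.mem_insert_of_mem hs), hzw⟩
    · rw [sup_le_iff] at haw
      exact hz w haw.1 (by simpa [haw.2] using hTw)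

end Upper

/-! ### Injective resolutions and Ext out of `I_z`. -/

section Lower

/-- Dually to filters, the part avoiding `y` is now the up-closed one, so it becomes the submodule
and the ideal of `a ⊓ y` the quotient. This yields injective coresolutions. -/
theorem mem_lowerPart_insert (a y : L) (T : Finset L) (b : L) :
    b ∈ lowerPart a T ↔ b ∈ lowerPart a (insert y T) ∨ b ∈ lowerPart (a ⊓ y) T := by
  simp only [lowerPart, Set.mem_ofPred_eq, le_inf_iff, Finset.forall_mem_insert]
  tauto

theorem not_le_of_mem_lowerPart (a y : L) (T : Finset L) :
    ∀ b ∈ lowerPart a (insert y T), ∀ c ∈ lowerPart (a ⊓ y) T, ¬ b ≤ c := fun _ hb _ hc h =>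
  hb.2 y (Finset.mem_insert_self y T) (h.trans (hc.1.trans inf_le_right))

/-- The short exact sequence that adds an element `y` to `T`. -/
theorem lowerPart_shortExact (a y : L) (T : Finset L) :
    (shortComplex K (mem_lowerPart_insert a y T) (not_le_of_mem_lowerPart a y T)).ShortExact :=
  shortExact _ _

instance (a : L) : Injective (obj K (lowerPart a ∅)) :=
  injective_of_forall_le (mem_lowerPart_empty a)

theorem hasInjectiveDimensionLT_lowerPart (T : Finset L) (a : L) :
    HasInjectiveDimensionLT (obj K (lowerPart a T)) (T.card + 1) := by
  induction T using Finset.induction_on generalizing a with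
  | empty => exact inferInstanceAs (HasInjectiveDimensionLT (obj K (lowerPart a ∅)) 1)
  | insert y T hy ih =>
    rw [Finset.card_insert_of_notMem hy]
    have := ih a
    exact (lowerPart_shortExact K a y T).hasInjectiveDimensionLT_X₁ (T.card + 1) (ih (a ⊓ y))
      (hasInjectiveDimensionLT_of_ge _ (T.card + 1) _ (Nat.le_succ _))

theorem hom_lowerPart_eq_zero {a z : L} (h : ¬ a ≤ z)
    (f : obj K (lowerPart z ∅) ⟶ obj K (lowerPart a ∅)) : f = 0 := by
  obtain ⟨k, hk, hf⟩ := exists_scalar_of_forall_le (mem_lowerPart_empty a) f.hom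
  rw [hk fun hz => h ((mem_lowerPart_empty z a).1 hz)] at hf
  refine ModuleCat.hom_ext (LinearMap.ext fun v =>
    ext_of_mem (K := K) (C := lowerPart a ∅) fun b hb => (hf v b hb).trans (zero_mul _))

/-- All meets of `a` with elements of `T` stay above `u`, so none is below `z` and every injective
term receives only zero from `I_z`. -/
theorem subsingleton_ext_lowerPart_of_le {z u : L} (hz : ¬ u ≤ z) (T : Finset L) {a : L}
    (ha : u ≤ a) (hT : ∀ t ∈ T, u ≤ t) (n : ℕ) :
    Subsingleton (Ext (obj K (lowerPart z ∅)) (obj K (lowerPart a T)) n) := by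
  induction T using Finset.induction_on generalizing a n with
  | empty =>
    cases n with
    | zero =>
      refine subsingleton_of_forall_eq 0 fun e => ?_
      obtain ⟨f, rfl⟩ := (Ext.mk₀_bijective _ _).2 e
      rw [hom_lowerPart_eq_zero K (fun h => hz (ha.trans h)) f, Ext.mk₀_zero]
    | succ n => exact HasInjectiveDimensionLT.subsingleton _ 1 _ (by lia) _
  | insert y T hy ih =>
    rw [Finset.forall_mem_insert] at hT
    exact (lowerPart_shortExact K a y T).subsingleton_ext_X₁ (ih (le_inf ha hT.1) hT.2)
      (ih ha hT.2) n

variable {K} in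
/-- Multiplication by a scalar, between the functions on two principal ideals. -/
noncomputable def idealScalar {a z : L} (h : a ≤ z) (k : K) :
    ConvexModule K (lowerPart z ∅) →ₗ[(IncidenceAlgebra K L)ᵐᵒᵖ] ConvexModule K (lowerPart a ∅) :=
  map k (fun _ _ _ c hc _ => (mem_lowerPart_empty z c).2 (((mem_lowerPart_empty a c).1 hc).trans h))
    (fun b _ c _ hc hbc =>
      (mem_lowerPart_empty a b).2 (hbc.trans ((mem_lowerPart_empty a c).1 hc)))

variable {K} in
theorem idealScalar_apply {a z : L} (h : a ≤ z) (k : K) (v : ConvexModule K (lowerPart z ∅))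
    {b : L} (hb : b ∈ lowerPart a ∅) : idealScalar h k v b = k * v b := by
  rw [idealScalar, map_apply _ _ _ _ hb]

theorem bijective_comp_lowerPart {z a y : L} (h : a ⊓ y ≤ z → a ≤ z) :
    Function.Bijective fun f : obj K (lowerPart z ∅) ⟶ obj K (lowerPart a ∅) =>
      f ≫ ModuleCat.ofHom
        (restrict K (mem_lowerPart_insert a y ∅) (not_le_of_mem_lowerPart a y ∅)) := by
  by_cases hza : a ≤ z
  · have hy : a ⊓ y ∈ lowerPart (a ⊓ y) ∅ := (mem_lowerPart_empty _ _).2 le_rfl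
    have hyz : a ⊓ y ∈ lowerPart z ∅ := (mem_lowerPart_empty _ _).2 (inf_le_left.trans hza)
    have hya : a ⊓ y ∈ lowerPart a ∅ := (mem_lowerPart_empty _ _).2 inf_le_left
    constructor
    · refine (injective_iff_map_eq_zero (Preadditive.rightComp _ (ModuleCat.ofHom _))).2
        fun f hf => ?_
      obtain ⟨k, -, hk⟩ := exists_scalar_of_forall_le (mem_lowerPart_empty a) f.hom
      have h0 := hk (single K _ (a ⊓ y)) _ hya
      rw [single_self hyz, mul_one] at h0
      have : k = 0 := h0.symm.trans <| (restrict_apply (mem_lowerPart_insert a y ∅)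
        (not_le_of_mem_lowerPart a y ∅) _ hy).symm.trans
        (congrArg (fun g => ConvexModule.toFun (C := lowerPart (a ⊓ y) ∅)
          (g.hom (single K (lowerPart z ∅) (a ⊓ y))) (a ⊓ y)) hf)
      subst this
      exact ModuleCat.hom_ext (LinearMap.ext fun v =>
        ext_of_mem (K := K) (C := lowerPart a ∅) fun b hb => (hk v b hb).trans (zero_mul _))
    · intro g
      obtain ⟨k, -, hk⟩ := exists_scalar_of_forall_le (mem_lowerPart_empty (a ⊓ y)) g.hom
      refine ⟨ModuleCat.ofHom (idealScalar hza k), ?_⟩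
      · refine ModuleCat.hom_ext (LinearMap.ext fun v =>
          ext_of_mem (K := K) (C := lowerPart (a ⊓ y) ∅) fun b hb =>
            (restrict_apply (C := lowerPart a ∅) (mem_lowerPart_insert a y ∅)
              (not_le_of_mem_lowerPart a y ∅) _ hb).trans ?_)
        refine Eq.trans ?_ (hk v b hb).symm
        exact idealScalar_apply hza k v ((mem_lowerPart_insert a y ∅ b).2 (.inr hb))
  · have : Subsingleton (obj K (lowerPart z ∅) ⟶ obj K (lowerPart a ∅)) :=
      subsingleton_of_forall_eq 0 (hom_lowerPart_eq_zero K hza)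
    exact ⟨Function.injective_of_subsingleton _, fun g =>
      ⟨0, (Limits.zero_comp).trans (hom_lowerPart_eq_zero K (fun hz => hza (h hz)) g).symm⟩⟩

theorem subsingleton_ext_lowerPart_insert {z y : L} (T : Finset L) {a : L}
    (h : ∀ c, c ≤ a → c ⊓ y ≤ z → c ≤ z) (n : ℕ) :
    Subsingleton (Ext (obj K (lowerPart z ∅)) (obj K (lowerPart a (insert y T))) n) := by
  induction T using Finset.induction_on generalizing a n with
  | empty =>
    exact (lowerPart_shortExact K a y ∅).subsingleton_ext_X₁_of_bijective
      (bijective_comp_lowerPart K (h a le_rfl)) n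
  | insert t T ht ih =>
    rw [Finset.insert_comm]
    exact (lowerPart_shortExact K a t (insert y T)).subsingleton_ext_X₁
      (ih fun c hc => h c (hc.trans inf_le_left)) (ih h) n

/-- Covariant dimension shifting: the witness for `y` kills Ext into the middle term, and the
remaining witnesses lie below `a ⊓ y`. -/
theorem subsingleton_ext_lowerPart_of_lt_card {z : L} (T : Finset L) {a : L}
    (h : ∀ y ∈ T, ∃ u, u ≤ a ∧ (∀ t ∈ T, t ≠ y → u ≤ t) ∧ ¬ u ≤ z) {n : ℕ} (hn : n < T.card) :
    Subsingleton (Ext (obj K (lowerPart z ∅)) (obj K (lowerPart a T)) n) := by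
  induction T using Finset.induction_on generalizing a n with
  | empty => simp at hn
  | insert y T hy ih =>
    obtain ⟨u, hau, hTu, hzu⟩ := h y (Finset.mem_insert_self y T)
    have hT := subsingleton_ext_lowerPart_of_le K hzu T hau fun t ht =>
      hTu t (Finset.mem_insert_of_mem ht) fun h => hy (h ▸ ht)
    rw [Finset.card_insert_of_notMem hy] at hn
    cases n with
    | zero => exact (lowerPart_shortExact K a y T).subsingleton_ext_X₁_zero (hT 0)
    | succ n =>
      refine (lowerPart_shortExact K a y T).subsingleton_ext_X₁_succ (ih (fun t ht => ?_)
        (by lia)) (hT _)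
      obtain ⟨w, haw, hTw, hzw⟩ := h t (Finset.mem_insert_of_mem ht)
      exact ⟨w, le_inf haw (hTw y (Finset.mem_insert_self y T) fun h => hy (h ▸ ht)),
        fun s hs => hTw s (Finset.mem_insert_of_mem hs), hzw⟩

theorem nontrivial_ext_lowerPart_card {z : L} (T : Finset L) {a : L}
    (h : ∀ y ∈ T, ∃ u, u ≤ a ∧ (∀ t ∈ T, t ≠ y → u ≤ t) ∧ ¬ u ≤ z)
    (hz : ∀ u, u ≤ a → (∀ t ∈ T, u ≤ t) → u ≤ z) :
    Nontrivial (Ext (obj K (lowerPart z ∅)) (obj K (lowerPart a T)) T.card) := by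
  induction T using Finset.induction_on generalizing a with
  | empty =>
    have hza : a ≤ z := hz a le_rfl (by simp)
    rw [Finset.card_empty]
    refine ⟨Ext.mk₀ (ModuleCat.ofHom (idealScalar hza 1)), 0, fun h0 => ?_⟩
    · rw [Ext.mk₀_eq_zero_iff] at h0
      have := congrArg (fun g => ConvexModule.toFun (C := lowerPart a ∅)
        (g.hom (single K (lowerPart z ∅) a)) a) h0
      refine one_ne_zero (α := K) (Eq.trans ?_ this)
      refine Eq.trans ?_ (idealScalar_apply hza 1 _ ((mem_lowerPart_empty _ _).2 le_rfl)).symm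
      rw [single_self ((mem_lowerPart_empty _ _).2 hza), mul_one]
  | insert y T hy ih =>
    obtain ⟨u, hau, hTu, hzu⟩ := h y (Finset.mem_insert_self y T)
    have hT := subsingleton_ext_lowerPart_of_le K hzu T hau fun t ht =>
      hTu t (Finset.mem_insert_of_mem ht) fun h => hy (h ▸ ht)
    rw [Finset.card_insert_of_notMem hy]
    refine (lowerPart_shortExact K a y T).nontrivial_ext_X₁_succ
      (ih (fun t ht => ?_) fun w haw hTw => ?_) (hT _)
    · obtain ⟨w, haw, hTw, hzw⟩ := h t (Finset.mem_insert_of_mem ht)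
      exact ⟨w, le_inf haw (hTw y (Finset.mem_insert_self y T) fun h => hy (h ▸ ht)),
        fun s hs => hTw s (Finset.mem_insert_of_mem hs), hzw⟩
    · rw [le_inf_iff] at haw
      exact hz w haw.1 (by simpa [haw.2] using hTw)

end Lower

end IncidenceAlgebra

/-! ### Grade and cograde as least degrees, and their invariance under isomorphism. -/

namespace RightModule

open Abelian

theorem sInf_natCast_eq {P : ℕ → Prop} {m : ℕ} (hm : P m) (hlt : ∀ n < m, ¬ P n) :
    sInf {n : ℕ∞ | ∃ l : ℕ, n = l ∧ P l} = m := by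
  refine le_antisymm (sInf_le ⟨m, rfl, hm⟩) (le_sInf ?_)
  rintro _ ⟨l, rfl, hl⟩
  exact Nat.cast_le.2 (not_lt.1 fun h => hlt l h hl)

theorem grade_eq_of_iso {A : Type w} [Ring A] {M N : ModuleCat.{w} Aᵐᵒᵖ} (e : M ≅ N) :
    grade M = grade N := by
  have (l : ℕ) : Nontrivial (Ext M (ModuleCat.of Aᵐᵒᵖ A) l) ↔
      Nontrivial (Ext N (ModuleCat.of Aᵐᵒᵖ A) l) :=
    ⟨Ext.nontrivial_of_retract_left e.retract, Ext.nontrivial_of_retract_left e.symm.retract⟩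
  simp only [grade, this]

theorem cograde_eq_of_iso (K : Type u) {A : Type (max u v)} [Field K] [Ring A] [Algebra K A]
    {M N : ModuleCat.{max u v} Aᵐᵒᵖ} (e : M ≅ N) :
    cograde.{u, v} K M = cograde.{u, v} K N := by
  have (l : ℕ) : Nontrivial (Ext (ModuleCat.of Aᵐᵒᵖ (DualModule K A)) M l) ↔
      Nontrivial (Ext (ModuleCat.of Aᵐᵒᵖ (DualModule K A)) N l) :=
    ⟨Ext.nontrivial_of_retract_right e.retract, Ext.nontrivial_of_retract_right e.symm.retract⟩
  simp only [cograde, this]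

end RightModule

/-! ### Independence of covers in a distributive lattice. -/

/-- In a finite distributive lattice, an element covering `x` does not lie below the join of the
other elements covering `x`. -/
theorem CovBy.exists_ge_not_ge {L : Type v} [DistribLattice L] [Finite L] {x y : L} (h : x ⋖ y) :
    ∃ u, x ≤ u ∧ (∀ t, x ⋖ t → t ≠ y → t ≤ u) ∧ ¬ y ≤ u := by
  -- Distinct covers of `x` meet in `x`, so by distributivity joining another cover to `u` stays in
  -- this set; a maximal `u` therefore contains all of them.
  obtain ⟨u, ⟨hxu, hyu⟩, hu⟩ := (Set.toFinite {u | x ≤ u ∧ y ⊓ u ≤ x}).exists_maximal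
    ⟨x, le_rfl, inf_le_right⟩
  refine ⟨u, hxu, fun t ht hty => ?_, fun hle => h.lt.not_ge (by rwa [inf_of_le_left hle] at hyu)⟩
  have hyt : y ⊓ t ≤ x := by
    by_contra hn
    have h₁ := (h.eq_or_eq (le_inf h.le ht.le) inf_le_left).resolve_left fun h => hn h.le
    have h₂ := (ht.eq_or_eq (le_inf h.le ht.le) inf_le_right).resolve_left fun h => hn h.le
    exact hty (h₂.symm.trans h₁)
  refine le_sup_right.trans (hu (y := u ⊔ t) ⟨hxu.trans le_sup_left, ?_⟩ le_sup_left)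
  rw [inf_sup_left]
  exact sup_le hyu hyt

theorem CovBy.exists_le_not_le {L : Type v} [DistribLattice L] [Finite L] {x y : L} (h : y ⋖ x) :
    ∃ u, u ≤ x ∧ (∀ t, t ⋖ x → t ≠ y → u ≤ t) ∧ ¬ u ≤ y := by
  obtain ⟨u, h₁, h₂, h₃⟩ := CovBy.exists_ge_not_ge h.toDual
  exact ⟨OrderDual.ofDual u, h₁, fun t ht hty => h₂ (OrderDual.toDual t) ht.toDual hty, h₃⟩

namespace IncidenceAlgebra

open Abelian ConvexModule

/-! ### Simple modules of the incidence algebra. -/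

section PartialOrder

variable (K : Type u) {L : Type v} [Field K] [PartialOrder L] [LocallyFiniteOrder L]
  [DecidableEq L] [Fintype L]

variable {K} in
/-- The simple module `S_x` as the module of functions supported at `x`. -/
noncomputable def simpleModIso {x : L} {C : Set L} [C.OrdConnected] (hC : ∀ b, b ∈ C ↔ b = x) :
    simpleMod K x ≅ obj K C :=
  LinearEquiv.toModuleIso
    { toFun s := ⟨fun b => if b = x then ULift.down s else 0, fun b hb => if_neg (mt (hC b).2 hb)⟩
      invFun v := ULift.up (v x)
      left_inv s := ULift.ext _ _ (if_pos rfl)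
      right_inv v := ext_of_mem fun b hb => by
        obtain rfl := (hC b).1 hb
        exact if_pos rfl
      map_add' s t := ext_of_mem fun b hb => by
        obtain rfl := (hC b).1 hb
        refine (if_pos rfl).trans (Eq.trans ?_ (ConvexModule.add_apply _ _ b).symm)
        exact congrArg₂ (· + ·) (if_pos rfl).symm (if_pos rfl).symm
      map_smul' f s := ext_of_mem fun b hb => by
        obtain rfl := (hC b).1 hb
        refine (if_pos rfl).trans (Eq.trans ?_ (ConvexModule.smul_apply f _ hb).symm)
        rw [Finset.sum_eq_single b (fun c _ hc => by simp [hc]) (by simp)]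
        simpa [mul_comm] using SimpleAt.op_smul_down K b f.unop s }

variable {K} in
theorem mul_basisElem_self_apply (f : IncidenceAlgebra K L) (b c d : L) :
    (f * basisElem K b b) c d = if d = b then f c b else 0 := by
  rw [mul_apply_univ, Finset.sum_eq_single b]
  · by_cases h : d = b
    · subst h
      simp [basisElem_apply]
    · simp [basisElem_apply_of_ne_right h, h]
  · intro a _ ha
    rw [basisElem_apply_of_ne_left ha, mul_zero]
  · simp

variable {K} in
theorem basisElem_self_mul_apply (f : IncidenceAlgebra K L) (b c d : L) :
    (basisElem K b b * f) c d = if c = b then f b d else 0 := by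
  rw [mul_apply_univ, Finset.sum_eq_single b]
  · by_cases h : c = b
    · subst h
      simp [basisElem_apply]
    · simp [basisElem_apply_of_ne_left h, h]
  · intro a _ ha
    rw [basisElem_apply_of_ne_right ha, zero_mul]
  · simp

variable (L) in
theorem sum_basisElem_self : ∑ b : L, basisElem K b b = 1 := by
  ext c d h
  rw [sum_apply, Finset.sum_eq_single c]
  · simp [basisElem_apply _ _ h, eq_comm]
  · intro b _ hb
    exact basisElem_apply_of_ne_left hb.symm
  · simp

/-- Every simple module over the incidence algebra of a finite poset is some `S_x`. -/
theorem exists_iso_simpleMod (M : ModuleCat.{max u v} (IncidenceAlgebra K L)ᵐᵒᵖ)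
    (hM : IsSimpleModule (IncidenceAlgebra K L)ᵐᵒᵖ M) : ∃ x : L, Nonempty (simpleMod K x ≅ M) := by
  have sum_smul (m : M) : ∑ b : L, op (basisElem K b b) • m = m := by
    rw [← Finset.sum_smul, ← Finset.op_sum, sum_basisElem_self, op_one, one_smul]
  have := IsSimpleModule.nontrivial (IncidenceAlgebra K L)ᵐᵒᵖ M
  obtain ⟨m, hm⟩ := exists_ne (0 : M)
  have hne : {x : L | ∃ m : M, op (basisElem K x x) • m ≠ 0}.Nonempty := by
    by_contra hempty
    refine hm ((sum_smul m).symm.trans (Finset.sum_eq_zero fun b _ => ?_))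
    by_contra hb
    exact hempty ⟨b, m, hb⟩
  -- By maximality of `x`, the diagonal idempotents above `x` kill the module, so no matrix unit can
  -- move the `x`-component upwards and it spans a copy of `S_x`.
  obtain ⟨x, ⟨m, hm⟩, hx⟩ := (Set.toFinite _).exists_maximal hne
  have hsmul (f : IncidenceAlgebra K L) : op f • op (basisElem K x x) • m =
      op (f x x • (1 : IncidenceAlgebra K L)) • op (basisElem K x x) • m := by
    rw [smul_smul, smul_smul, ← op_mul, ← op_mul, ← sub_eq_zero, ← sub_smul, ← MulOpposite.op_sub,
      ← sum_smul ((op _ : (IncidenceAlgebra K L)ᵐᵒᵖ) • m)]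
    -- The difference is split by the idempotents at `b`: for `x < b` the module component is zero,
    -- and otherwise the algebra element itself is zero.
    refine Finset.sum_eq_zero fun b _ => ?_
    by_cases hxb : x < b
    · by_contra hb
      exact hxb.not_ge (hx ⟨_, hb⟩ hxb.le)
    · rw [smul_smul, ← op_mul]
      refine (congrArg (· • m) ?_).trans (zero_smul (IncidenceAlgebra K L)ᵐᵒᵖ m)
      rw [op_eq_zero_iff]
      ext c d hcd
      rw [mul_basisElem_self_apply, IncidenceAlgebra.zero_apply, IncidenceAlgebra.sub_apply,
        basisElem_self_mul_apply, basisElem_self_mul_apply]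
      split_ifs with h₁ h₂
      · obtain rfl | hne := eq_or_ne x b
        · simp [constSMul_apply]
        · simp [apply_eq_zero_of_not_le fun h => hxb (lt_of_le_of_ne h hne)]
      · simp
      · rfl
  let φ : SimpleAt K x →ₗ[(IncidenceAlgebra K L)ᵐᵒᵖ] M :=
    { toFun s := op (ULift.down s • (1 : IncidenceAlgebra K L)) • op (basisElem K x x) • m
      map_add' s t := by
        rw [← add_smul, ← MulOpposite.op_add, ← add_smul]
        rfl
      map_smul' f s := by
        have h := hsmul ((ULift.down s • 1) * f.unop)
        rw [op_mul, op_unop, mul_smul] at h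
        refine Eq.trans ?_ h.symm
        rw [Algebra.smul_mul_assoc, one_mul, constSMul_apply, smul_eq_mul, mul_comm]
        rfl }
  have hφ : φ ≠ 0 := fun h => hm <| by
    have : op ((1 : K) • (1 : IncidenceAlgebra K L)) • op (basisElem K x x) • m = 0 :=
      LinearMap.congr_fun h (show SimpleAt K x from ULift.up 1)
    rwa [one_smul, op_one, one_smul] at this
  have := SimpleAt.isSimpleModule K x
  exact ⟨x, ⟨(LinearEquiv.ofBijective φ (LinearMap.bijective_of_ne_zero hφ)).toModuleIso⟩⟩

end PartialOrder

/-! ### Grades and dimensions of `S_x` over a distributive lattice. -/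

section DistribLattice

variable (K : Type u) {L : Type v} [Field K] [DistribLattice L] [LocallyFiniteOrder L]
  [DecidableEq L] [Fintype L]

open Classical in
/-- The elements covering `x`. -/
noncomputable def covers (x : L) : Finset L := {y | x ⋖ y}

open Classical in
/-- The elements covered by `x`. -/
noncomputable def cocovers (x : L) : Finset L := {y | y ⋖ x}

theorem mem_covers {x y : L} : y ∈ covers x ↔ x ⋖ y := by simp [covers]

theorem mem_cocovers {x y : L} : y ∈ cocovers x ↔ y ⋖ x := by simp [cocovers]

/-- In a finite order everything strictly above `x` is above a cover of `x`; this places `S_x` in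
the family of truncated filters. -/
theorem mem_upperPart_covers (x b : L) : b ∈ upperPart x (covers x) ↔ b = x := by
  constructor
  · rintro ⟨hxb, hb⟩
    by_contra hne
    obtain ⟨y, hy, hyb⟩ := exists_covBy_le_of_lt (lt_of_le_of_ne hxb (Ne.symm hne))
    exact hb y (mem_covers.2 hy) hyb
  · rintro rfl
    exact ⟨le_rfl, fun t ht h => (mem_covers.1 ht).lt.not_ge h⟩

theorem mem_lowerPart_cocovers (x b : L) : b ∈ lowerPart x (cocovers x) ↔ b = x := by
  constructor
  · rintro ⟨hxb, hb⟩
    by_contra hne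
    obtain ⟨y, hy, hyb⟩ := exists_le_covBy_of_lt (lt_of_le_of_ne hxb hne)
    exact hb y (mem_cocovers.2 hyb) hy
  · rintro rfl
    exact ⟨le_rfl, fun t ht h => (mem_cocovers.1 ht).lt.not_ge h⟩

theorem subsingleton_ext_covers_of_lt (x z : L) {n : ℕ} (hn : n < (covers x).card) :
    Subsingleton (Ext (obj K (upperPart x (covers x))) (obj K (upperPart z ∅)) n) := by
  by_cases h : ∀ y ∈ covers x, y ≤ x ⊔ z
  · refine subsingleton_ext_upperPart_of_lt_card K _ (fun y hy => ?_) hn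
    obtain ⟨u, hxu, hu, hyu⟩ := (mem_covers.1 hy).exists_ge_not_ge
    exact ⟨u, hxu, fun t ht => hu t (mem_covers.1 ht),
      fun hzu => hyu ((h y hy).trans (sup_le hxu hzu))⟩
  · push Not at h
    obtain ⟨y, hy, hyz⟩ := h
    rw [← Finset.insert_erase hy]
    refine subsingleton_ext_upperPart_insert K _ (fun c hxc hz => ?_) n
    have hxy := mem_covers.1 hy
    -- Hence `z ⊓ y ≤ x`, and distributivity turns `z ≤ c ⊔ y` into `z ≤ c` for every `c` above `x`.
    have hyx : y ⊓ (x ⊔ z) = x := (hxy.eq_or_eq (le_inf hxy.le le_sup_left)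
      inf_le_left).resolve_right fun h => hyz (inf_eq_left.1 h)
    calc z = z ⊓ (c ⊔ y) := (inf_eq_left.2 hz).symm
      _ = z ⊓ c ⊔ z ⊓ y := inf_sup_left _ _ _
      _ ≤ c := sup_le inf_le_right <| le_trans (le_inf inf_le_right
          (inf_le_left.trans le_sup_right)) (hyx.le.trans hxc)

theorem subsingleton_ext_cocovers_of_lt (x z : L) {n : ℕ} (hn : n < (cocovers x).card) :
    Subsingleton (Ext (obj K (lowerPart z ∅)) (obj K (lowerPart x (cocovers x))) n) := by
  by_cases h : ∀ y ∈ cocovers x, x ⊓ z ≤ y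
  · refine subsingleton_ext_lowerPart_of_lt_card K _ (fun y hy => ?_) hn
    obtain ⟨u, hxu, hu, hyu⟩ := (mem_cocovers.1 hy).exists_le_not_le
    exact ⟨u, hxu, fun t ht => hu t (mem_cocovers.1 ht),
      fun hzu => hyu ((le_inf hxu hzu).trans (h y hy))⟩
  · push Not at h
    obtain ⟨y, hy, hyz⟩ := h
    rw [← Finset.insert_erase hy]
    refine subsingleton_ext_lowerPart_insert K _ (fun c hxc hz => ?_) n
    have hxy := mem_cocovers.1 hy
    have hyx : y ⊔ (x ⊓ z) = x := (hxy.eq_or_eq le_sup_left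
      (sup_le hxy.le inf_le_left)).resolve_left fun h => hyz (sup_eq_left.1 h)
    calc c ≤ (z ⊔ c) ⊓ (z ⊔ y) := le_inf le_sup_right <| hxc.trans <| hyx.ge.trans <|
          sup_le le_sup_right (inf_le_right.trans le_sup_left)
      _ = z ⊔ c ⊓ y := (sup_inf_left _ _ _).symm
      _ ≤ z := sup_le le_rfl hz

theorem exists_nontrivial_ext_covers (x : L) : ∃ z : L, Nontrivial
    (Ext (obj K (upperPart x (covers x))) (obj K (upperPart z ∅)) (covers x).card) := by
  -- This `z` lies below `u` exactly when `x` and all its covers do. Including `x` keeps the join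
  -- defined when `x` has no cover.
  refine ⟨(insert x (covers x)).sup' (Finset.insert_nonempty _ _) id,
    nontrivial_ext_upperPart_card K _ (fun y hy => ?_) fun u hxu hu => ?_⟩
  · obtain ⟨u, hxu, hu, hyu⟩ := (mem_covers.1 hy).exists_ge_not_ge
    exact ⟨u, hxu, fun t ht => hu t (mem_covers.1 ht),
      fun hzu => hyu ((Finset.le_sup' id (Finset.mem_insert_of_mem hy)).trans hzu)⟩
  · exact Finset.sup'_le _ _ (by simpa [hxu] using hu)

theorem exists_nontrivial_ext_cocovers (x : L) : ∃ z : L, Nontrivial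
    (Ext (obj K (lowerPart z ∅)) (obj K (lowerPart x (cocovers x))) (cocovers x).card) := by
  refine ⟨(insert x (cocovers x)).inf' (Finset.insert_nonempty _ _) id,
    nontrivial_ext_lowerPart_card K _ (fun y hy => ?_) fun u hxu hu => ?_⟩
  · obtain ⟨u, hxu, hu, hyu⟩ := (mem_cocovers.1 hy).exists_le_not_le
    exact ⟨u, hxu, fun t ht => hu t (mem_cocovers.1 ht),
      fun hzu => hyu (hzu.trans (Finset.inf'_le id (Finset.mem_insert_of_mem hy)))⟩
  · exact Finset.le_inf' _ _ (by simpa [hxu] using hu)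

/-- Nonvanishing needs only one summand `P_z` of `A`; vanishing in lower degrees needs all of them.
-/
theorem grade_simpleMod (x : L) : RightModule.grade (simpleMod K x) = (covers x).card := by
  rw [RightModule.grade_eq_of_iso (simpleModIso (mem_upperPart_covers x))]
  refine RightModule.sInf_natCast_eq ?_ fun n hn => ?_
  · obtain ⟨z, hz⟩ := exists_nontrivial_ext_covers K x
    exact Ext.nontrivial_of_retract_right (retractRegular (mem_upperPart_empty z)) hz
  · rw [not_nontrivial_iff_subsingleton]
    exact Ext.subsingleton_of_sum_comp_eq_id_right _ _
      (sum_row_comp_ofRow (fun a : L => upperPart a ∅) mem_upperPart_empty)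
      fun z => subsingleton_ext_covers_of_lt K x z hn

theorem cograde_simpleMod (x : L) :
    RightModule.cograde.{u, v} K (simpleMod K x) = (cocovers x).card := by
  rw [RightModule.cograde_eq_of_iso K (simpleModIso (mem_lowerPart_cocovers x))]
  refine RightModule.sInf_natCast_eq ?_ fun n hn => ?_
  · obtain ⟨z, hz⟩ := exists_nontrivial_ext_cocovers K x
    exact Ext.nontrivial_of_retract_left (retractDual (mem_lowerPart_empty z)) hz
  · rw [not_nontrivial_iff_subsingleton]
    exact Ext.subsingleton_of_sum_comp_eq_id_left _ _
      (sum_column_comp_ofColumn (fun a : L => lowerPart a ∅) mem_lowerPart_empty)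
      fun z => subsingleton_ext_cocovers_of_lt K x z hn

/-- The resolution bounds the dimension from above, and the nonzero Ext that attains the grade
bounds it from below. -/
theorem projectiveDimension_simpleMod (x : L) :
    projectiveDimension (simpleMod K x) = ((covers x).card : ℕ) := by
  rw [projectiveDimension_eq_of_iso (simpleModIso (mem_upperPart_covers x))]
  refine le_antisymm ((projectiveDimension_le_iff _ _).2
    (hasProjectiveDimensionLT_upperPart K (covers x) x)) ((projectiveDimension_ge_iff _ _).2
    fun h => ?_)
  obtain ⟨z, hz⟩ := exists_nontrivial_ext_covers K x
  exact not_subsingleton_iff_nontrivial.2 hz (HasProjectiveDimensionLT.subsingleton _ _ _ le_rfl _)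

theorem injectiveDimension_simpleMod (x : L) :
    injectiveDimension (simpleMod K x) = ((cocovers x).card : ℕ) := by
  rw [injectiveDimension_eq_of_iso (simpleModIso (mem_lowerPart_cocovers x))]
  refine le_antisymm ((injectiveDimension_le_iff _ _).2
    (hasInjectiveDimensionLT_lowerPart K (cocovers x) x)) ((injectiveDimension_ge_iff _ _).2
    fun h => ?_)
  obtain ⟨z, hz⟩ := exists_nontrivial_ext_cocovers K x
  exact not_subsingleton_iff_nontrivial.2 hz (HasInjectiveDimensionLT.subsingleton _ _ _ le_rfl _)

end DistribLattice

end IncidenceAlgebra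

theorem corollary3p3 (K : Type u) (L : Type v) [Field K] [DistribLattice L] [Finite L]
    [LocallyFiniteOrder L] [DecidableEq L] :
    (∀ x : L,
      ((RightModule.grade (IncidenceAlgebra.simpleMod K x) : ℕ∞) : WithBot ℕ∞) =
          projectiveDimension (IncidenceAlgebra.simpleMod K x) ∧
        projectiveDimension (IncidenceAlgebra.simpleMod K x) =
          (({y : L | x ⋖ y}.ncard : ℕ) : WithBot ℕ∞) ∧
        ((RightModule.cograde.{u, v} K (IncidenceAlgebra.simpleMod K x) : ℕ∞) : WithBot ℕ∞) =
          injectiveDimension (IncidenceAlgebra.simpleMod K x) ∧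
        injectiveDimension (IncidenceAlgebra.simpleMod K x) =
          (({y : L | y ⋖ x}.ncard : ℕ) : WithBot ℕ∞)) ∧
    (∀ M : ModuleCat.{max u v} (IncidenceAlgebra K L)ᵐᵒᵖ,
      IsSimpleModule (IncidenceAlgebra K L)ᵐᵒᵖ M → RightModule.IsPerfect M) := by
  have := Fintype.ofFinite L
  refine ⟨fun x => ?_, fun M hM => ?_⟩
  · have h₁ : {y : L | x ⋖ y} = IncidenceAlgebra.covers x :=
      Set.ext fun y => IncidenceAlgebra.mem_covers.symm
    have h₂ : {y : L | y ⋖ x} = IncidenceAlgebra.cocovers x :=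
      Set.ext fun y => IncidenceAlgebra.mem_cocovers.symm
    rw [h₁, h₂, Set.ncard_coe_finset, Set.ncard_coe_finset, IncidenceAlgebra.grade_simpleMod,
      IncidenceAlgebra.cograde_simpleMod, IncidenceAlgebra.projectiveDimension_simpleMod,
      IncidenceAlgebra.injectiveDimension_simpleMod]
    exact ⟨rfl, rfl, rfl, rfl⟩
  · obtain ⟨x, ⟨e⟩⟩ := IncidenceAlgebra.exists_iso_simpleMod K M hM
    rw [RightModule.IsPerfect, ← projectiveDimension_eq_of_iso e, ← RightModule.grade_eq_of_iso e,
      IncidenceAlgebra.grade_simpleMod, IncidenceAlgebra.projectiveDimension_simpleMod]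
    exact ⟨rfl, WithBot.coe_lt_coe.2 (ENat.natCast_lt_top _)⟩
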